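/- **Gap above the droplet band for the strip.** Let $L\ge 2$ and $M=2J\ge 2$ be integers. Let $\mathcal G=(\mathcal V,\mathcal E)$ be the strip of width $L$: $\mathcal V=\mathbb Z\times\{1,\dots,L\}$, with $(z_1,\ell_1)\sim(z_2,\ell_2)$ iff $|z_1-z_2|+|\ell_1-\ell_2|=1$. For $N\ge 0$ let $\mathfrak M_N$ be the set of finitely supported $\mathfrak m:\mathcal V\to\{0,\dots,M\}$ with $\sum_x\mathfrak m(x)=N$. Call $\mathfrak m,\mathfrak n\in\mathfrak M_N$ adjacent, $\mathfrak m\sim\mathfrak n$, if for some edge $\{x_+,x_-\}\in\mathcal E$ we have $\mathfrak m(x_\pm)=\mathfrak n(x_\pm)\pm1$ and $\mathfrak m=\mathfrak n$ at all other sites; then put $$w(\mathfrak m,\mathfrak n)=\prod_{x:\,\mathfrak m(x)\ne\mathfrak n(x)}\Big(\tfrac M2(\mathfrak m(x)+\mathfrak n(x)+1)-\mathfrak m(x)\mathfrak n(x)\Big)^{1/2}.$$ Put $$V_N(\mathfrak m)=\sum_{\{x,y\}\in\mathcal E}\Big(\tfrac M2(\mathfrak m(x)+\mathfrak m(y))-\mathfrak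 m(x)\mathfrak m(y)\Big).$$ On $\ell^2(\mathfrak M_N)$, the spin-$J$ XXZ Hamiltonian with anisotropy $\Delta$ is the bounded self-adjoint operator $$(H^N_{\mathcal G}f)(\mathfrak m)=-\frac1{2\Delta}\sum_{\mathfrak n\sim\mathfrak m}w(\mathfrak m,\mathfrak n)f(\mathfrak n)+V_N(\mathfrak m)f(\mathfrak m).$$ Let $V_{N,2}$ be the second lowest value of $V_N$, and let $\delta_N=\sigma(H^N_{\mathcal G})\cap\big(0,(1-\tfrac M\Delta)V_{N,2}\big)$ be the droplet spectrum. Let $\mathcal S=\{kLM:\ k\in\mathbb N,\ k\ge L/2\}$ and let $\widehat H=\bigoplus_{N\in\mathcal S}H^N_{\mathcal G}$ be the restricted Hamiltonian, a (self-adjoint) operator on the Hilbert sum of the spaces $\ell^2(\mathfrak M_N)$, $N\in\mathcal S$, with its maximal domain. Then there is a constant $C=C(L,M)$ such that for every $\Delta>LM^3+(1+\sqrt{2L})M$ there are real numbers $E_-<E_+$, not depending on $N$, with $$LM^2\le E_-\le LM^2+\frac C{\Delta^2},\qquad \Big(1-\frac M\Delta\Big)(LM^2+1)-\frac C{\Delta^2}\le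 E_+\le\Big(1-\frac M\Delta\Big)(LM^2+1),$$ such that: 1. for every $N\in\mathcal S$, $(E_-,E_+)$ is a spectral gap of $H_{\mathcal G}^N$, that is, $\sigma(H_{\mathcal G}^N)\cap(E_-,E_+)=\emptyset$ while $\sigma(H_{\mathcal G}^N)$ meets both $(-\infty,E_-]$ and $[E_+,\infty)$; moreover this gap lies above the droplet spectrum: $\delta_N\neq\emptyset$ and $\delta_N\subset(-\infty,E_-]$; 2. the same interval $(E_-,E_+)$ is a spectral gap, in the same sense, of $\widehat H$. -/

import Mathlib

/-!  Spin-J XXZ Hamiltonians in their N-particle Schrödinger form, `M = 2J`.  -/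

noncomputable section

namespace XXZ

/-- Configurations of `N` particles on the vertex set `V` with at most `M` particles per site
(finitely supported functions `V → {0, …, M}` with total sum `N`). -/
def Config (V : Type*) (M N : ℕ) : Type _ :=
  {m : V →₀ ℕ // (∀ x, m x ≤ M) ∧ (m.sum fun _ j => j) = N}

variable {V : Type*} {M N : ℕ}

/-- Occupation number of the site `x`. -/
def Config.occ (m : Config V M N) (x : V) : ℕ := m.1 x

/-- The `N`-particle graph with maximal local occupation number `M` over the graph `G`: two
configurations are adjacent when one arises from the other by moving one particle along an edge. -/
def particleGraph (G : SimpleGraph V) (M N : ℕ) : SimpleGraph (Config V M N) where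
  Adj m n := ∃ x y, G.Adj x y ∧ m.occ x = n.occ x + 1 ∧ n.occ y = m.occ y + 1 ∧
    ∀ z, z ≠ x → z ≠ y → m.occ z = n.occ z
  symm := ⟨by
    rintro m n ⟨x, y, h, hx, hy, hz⟩
    exact ⟨y, x, h.symm, hy, hx, fun z h1 h2 => (hz z h2 h1).symm⟩⟩
  loopless := ⟨by
    rintro m ⟨x, y, h, hx, hy, hz⟩
    omega⟩

open Classical in
/-- The weight `w(m,n) = ∏_{x : m(x) ≠ n(x)} (M/2 (m(x)+n(x)+1) - m(x) n(x))^{1/2}`. -/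
def weight (m n : Config V M N) : ℝ :=
  ∏ x ∈ m.1.neLocus n.1,
    Real.sqrt ((M : ℝ) / 2 * (m.occ x + n.occ x + 1) - m.occ x * n.occ x)

/-- The two-site interaction `v(m(x),m(y)) = M/2 (m(x)+m(y)) - m(x) m(y)` on an edge `{x,y}`. -/
def edgePotential (m : Config V M N) (e : Sym2 V) : ℝ :=
  Sym2.lift ⟨fun x y => (M : ℝ) / 2 * (m.occ x + m.occ y) - m.occ x * m.occ y,
    fun x y => by ring⟩ e

/-- The interaction potential `V_N(m)`: the sum of the two-site interactions over all edges of `G`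
(on a graph of bounded degree, only finitely many terms are non-zero). -/
def potential (G : SimpleGraph V) (m : Config V M N) : ℝ :=
  ∑ᶠ e ∈ G.edgeSet, edgePotential m e

/-- The `N`-particle Hilbert space `ℓ²` over configurations. -/
abbrev HilbertN (V : Type*) (M N : ℕ) : Type _ := lp (fun _ : Config V M N => ℂ) 2

/-- Graphs of bounded maximal degree. -/
def BoundedDegree (G : SimpleGraph V) : Prop := ∃ d : ℕ, ∀ x, (G.neighborSet x).encard ≤ d

/-! ### Boundedness of the adjacency operator and of the potential -/

lemma occ_le (m : Config V M N) (x : V) : m.occ x ≤ M := m.2.1 x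

lemma card_support_le (m : Config V M N) : m.1.support.card ≤ N := by
  calc m.1.support.card = ∑ x ∈ m.1.support, 1 := by simp
    _ ≤ ∑ x ∈ m.1.support, m.1 x := Finset.sum_le_sum fun x hx =>
        Nat.one_le_iff_ne_zero.2 (by simpa using hx)
    _ = N := m.2.2

lemma Config.ext' {m n : Config V M N} (h : ∀ x, m.occ x = n.occ x) : m = n :=
  Subtype.ext (Finsupp.ext h)

/-- Ordered edges that start in the support of `m`. -/
def moves (G : SimpleGraph V) (m : Config V M N) : Set (V × V) :=
  {p | p.1 ∈ m.1.support ∧ G.Adj p.1 p.2}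

lemma moves_encard_le (G : SimpleGraph V) {d : ℕ} (hd : ∀ x, (G.neighborSet x).encard ≤ d)
    (m : Config V M N) : (moves G m).encard ≤ (N * d : ℕ) := by
  classical
  have hfin : ∀ x, (G.neighborSet x).Finite := fun x =>
    Set.finite_of_encard_le_coe (hd x)
  let F : Finset (V × V) := m.1.support.biUnion fun x =>
    (hfin x).toFinset.map ⟨fun y => (x, y), fun a b h => by simpa using h⟩
  have hF : moves G m ⊆ (F : Set (V × V)) := by
    rintro ⟨x, y⟩ ⟨hx, hy⟩
    simp only [F, Finset.coe_biUnion, Set.mem_iUnion]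
    refine ⟨x, hx, ?_⟩
    simp only [Finset.coe_map, Set.mem_image, Finset.mem_coe, Set.Finite.mem_toFinset]
    exact ⟨y, hy, rfl⟩
  refine (Set.encard_le_encard hF).trans ?_
  rw [Set.encard_coe_eq_coe_finsetCard]
  refine Nat.cast_le.2 ?_
  refine (Finset.card_biUnion_le_card_mul _ _ d fun x _ => ?_).trans
    (Nat.mul_le_mul_right d (card_support_le m))
  rw [Finset.card_map]
  have := hd x
  rw [(hfin x).encard_eq_coe_toFinset_card] at this
  exact_mod_cast this

lemma neighbor_encard_le (G : SimpleGraph V) {d : ℕ} (hd : ∀ x, (G.neighborSet x).encard ≤ d)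
    (m : Config V M N) : ((particleGraph G M N).neighborSet m).encard ≤ (N * d : ℕ) := by
  classical
  refine le_trans ?_ (moves_encard_le G hd m)
  let P : Config V M N → V × V → Prop := fun n p =>
    G.Adj p.1 p.2 ∧ m.occ p.1 = n.occ p.1 + 1 ∧ n.occ p.2 = m.occ p.2 + 1 ∧
        ∀ z, z ≠ p.1 → z ≠ p.2 → m.occ z = n.occ z
  let g : V × V → Config V M N := fun p => if h : ∃ n, P n p then h.choose else m
  refine le_trans (Set.encard_le_encard ?_) (Set.encard_image_le g (moves G m))
  rintro n ⟨x, y, h, hx, hy, hz⟩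
  refine ⟨(x, y), ⟨?_, h⟩, ?_⟩
  · have h0 : m.1 x ≠ 0 := by
      change m.occ x ≠ 0
      omega
    simpa using h0
  · have hex : ∃ n, P n (x, y) := ⟨n, h, hx, hy, hz⟩
    have hg : g (x, y) = hex.choose := dif_pos hex
    rw [hg]
    obtain ⟨-, hx', hy', hz'⟩ := hex.choose_spec
    refine Config.ext' fun z => ?_
    by_cases h1 : z = x
    · subst h1
      simp only at hx'
      omega
    by_cases h2 : z = y
    · subst h2
      simp only at hy'
      omega
    rw [← hz z h1 h2, ← hz' z h1 h2]

lemma weight_nonneg (m n : Config V M N) : 0 ≤ weight m n :=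
  Finset.prod_nonneg fun _ _ => Real.sqrt_nonneg _

lemma weight_le (G : SimpleGraph V) {m n : Config V M N} (h : (particleGraph G M N).Adj m n) :
    weight m n ≤ ((M : ℝ) + 1) ^ 2 := by
  classical
  obtain ⟨x, y, -, -, -, hz⟩ := h
  have hsub : m.1.neLocus n.1 ⊆ {x, y} := by
    intro z hz'
    rw [Finsupp.mem_neLocus] at hz'
    by_contra hcon
    simp only [Finset.mem_insert, Finset.mem_singleton, not_or] at hcon
    exact hz' (hz z hcon.1 hcon.2)
  have hcard : (m.1.neLocus n.1).card ≤ 2 :=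
    (Finset.card_le_card hsub).trans Finset.card_le_two
  unfold weight
  have h1 : ∀ z ∈ m.1.neLocus n.1,
      Real.sqrt ((M : ℝ) / 2 * (m.occ z + n.occ z + 1) - m.occ z * n.occ z) ≤ (M : ℝ) + 1 := by
    intro z _
    have a : (m.occ z : ℝ) ≤ M := Nat.cast_le.2 (occ_le m z)
    have b : (n.occ z : ℝ) ≤ M := Nat.cast_le.2 (occ_le n z)
    have a0 : (0 : ℝ) ≤ m.occ z := Nat.cast_nonneg _
    have b0 : (0 : ℝ) ≤ n.occ z := Nat.cast_nonneg _
    have M0 : (0 : ℝ) ≤ M := Nat.cast_nonneg _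
    refine Real.sqrt_le_iff.2 ⟨by positivity, ?_⟩
    nlinarith [mul_nonneg a0 b0, mul_le_mul_of_nonneg_left (add_le_add a b) M0]
  have M1 : (1 : ℝ) ≤ (M : ℝ) + 1 := by
    have : (0 : ℝ) ≤ M := Nat.cast_nonneg _
    linarith
  calc _ ≤ ∏ _z ∈ m.1.neLocus n.1, ((M : ℝ) + 1) :=
        Finset.prod_le_prod (fun _ _ => Real.sqrt_nonneg _) h1
    _ = ((M : ℝ) + 1) ^ (m.1.neLocus n.1).card := by simp
    _ ≤ _ := pow_le_pow_right₀ M1 hcard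

lemma edgePotential_bound (m : Config V M N) (e : Sym2 V) :
    0 ≤ edgePotential m e ∧ edgePotential m e ≤ (M : ℝ) ^ 2 := by
  induction e with
  | _ x y =>
    have a : (m.occ x : ℝ) ≤ M := Nat.cast_le.2 (occ_le m x)
    have b : (m.occ y : ℝ) ≤ M := Nat.cast_le.2 (occ_le m y)
    have a0 : (0 : ℝ) ≤ m.occ x := Nat.cast_nonneg _
    have b0 : (0 : ℝ) ≤ m.occ y := Nat.cast_nonneg _
    change 0 ≤ (M : ℝ) / 2 * (m.occ x + m.occ y) - m.occ x * m.occ y ∧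
      (M : ℝ) / 2 * (m.occ x + m.occ y) - m.occ x * m.occ y ≤ (M : ℝ) ^ 2
    constructor
    · nlinarith [mul_nonneg a0 (sub_nonneg.2 b), mul_nonneg b0 (sub_nonneg.2 a)]
    · nlinarith [mul_nonneg a0 b0]

lemma potential_bound (G : SimpleGraph V) {d : ℕ} (hd : ∀ x, (G.neighborSet x).encard ≤ d)
    (m : Config V M N) : |potential G m| ≤ (N * d : ℕ) * (M : ℝ) ^ 2 := by
  classical
  have hfin : (moves G m).Finite := Set.finite_of_encard_le_coe (moves_encard_le G hd m)
  have hcard : hfin.toFinset.card ≤ N * d := by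
    have := moves_encard_le G hd m
    rw [hfin.encard_eq_coe_toFinset_card] at this
    exact_mod_cast this
  let F : Finset (Sym2 V) := hfin.toFinset.image fun p => s(p.1, p.2)
  have hFc : F.card ≤ N * d := Finset.card_image_le.trans hcard
  have hF : ∀ e, e ∈ F → e ∈ G.edgeSet := by
    intro e he
    simp only [F, Finset.mem_image, Set.Finite.mem_toFinset] at he
    obtain ⟨p, hp, rfl⟩ := he
    exact hp.2
  have hz : ∀ e ∈ G.edgeSet, edgePotential m e ≠ 0 → e ∈ F := by
    intro e he hne
    induction e with
    | _ x y =>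
      simp only [F, Finset.mem_image, Set.Finite.mem_toFinset]
      have hxy : m.occ x ≠ 0 ∨ m.occ y ≠ 0 := by
        by_contra hcon
        push Not at hcon
        apply hne
        change (M : ℝ) / 2 * (m.occ x + m.occ y) - m.occ x * m.occ y = 0
        simp [hcon.1, hcon.2]
      rcases hxy with h | h
      · exact ⟨(x, y), ⟨Finsupp.mem_support_iff.2 h, he⟩, rfl⟩
      · exact ⟨(y, x), ⟨Finsupp.mem_support_iff.2 h, (G.adj_comm x y).1 he⟩, Sym2.eq_swap⟩
  have hsum : potential G m = ∑ e ∈ F, edgePotential m e := by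
    unfold potential
    refine finsum_mem_eq_sum_of_inter_support_eq _ ?_
    ext e
    simp only [Set.mem_inter_iff, Function.mem_support, Finset.mem_coe]
    exact ⟨fun h => ⟨hz e h.1 h.2, h.2⟩, fun h => ⟨hF e h.1, h.2⟩⟩
  rw [hsum, abs_of_nonneg (Finset.sum_nonneg fun e _ => (edgePotential_bound m e).1)]
  calc _ ≤ ∑ _e ∈ F, (M : ℝ) ^ 2 := Finset.sum_le_sum fun e _ => (edgePotential_bound m e).2
    _ = F.card * (M : ℝ) ^ 2 := by simp
    _ ≤ _ := by gcongr

lemma sum_norm_sq_le {ι : Type*} (f : lp (fun _ : ι => ℂ) 2) (F : Finset ι) :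
    ∑ i ∈ F, ‖f i‖ ^ 2 ≤ ‖f‖ ^ 2 := by
  have := lp.sum_rpow_le_norm_rpow (p := 2) (by norm_num) f F
  simpa using this

/-- A kernel with uniformly bounded entries and at most `D` entries in each row and column maps
`ℓ²` to `ℓ²`. -/
lemma schur_bound {ι : Type*} (s : ι → Set ι) (hs : ∀ i j, j ∈ s i ↔ i ∈ s j) (D : ℕ)
    (hD : ∀ i, (s i).encard ≤ D) (K : ι → ι → ℝ) (W : ℝ) (hK : ∀ i, ∀ j ∈ s i, |K i j| ≤ W)
    (f : lp (fun _ : ι => ℂ) 2) (F : Finset ι) :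
    ∑ i ∈ F, ‖∑ᶠ j ∈ s i, (K i j : ℂ) * f j‖ ^ 2 ≤ (W * D * ‖f‖) ^ 2 := by
  classical
  have hfin : ∀ i, (s i).Finite := fun i => Set.finite_of_encard_le_coe (hD i)
  set t : ι → Finset ι := fun i => (hfin i).toFinset with ht
  have htc : ∀ i, (t i).card ≤ D := by
    intro i
    have := hD i
    rw [(hfin i).encard_eq_coe_toFinset_card] at this
    exact_mod_cast this
  have hmem : ∀ i j, j ∈ t i ↔ j ∈ s i := fun i j => by simp [ht]
  have h1 : ∀ i, ‖∑ᶠ j ∈ s i, (K i j : ℂ) * f j‖ ^ 2 ≤ W ^ 2 * D * ∑ j ∈ t i, ‖f j‖ ^ 2 := by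
    intro i
    rw [finsum_mem_eq_finite_toFinset_sum _ (hfin i)]
    have hle : ‖∑ j ∈ t i, (K i j : ℂ) * f j‖ ≤ ∑ j ∈ t i, |K i j| * ‖f j‖ :=
      (norm_sum_le _ _).trans (Finset.sum_le_sum fun j _ => by
        rw [norm_mul, Complex.norm_real, Real.norm_eq_abs])
    calc ‖∑ j ∈ t i, (K i j : ℂ) * f j‖ ^ 2 ≤ (∑ j ∈ t i, |K i j| * ‖f j‖) ^ 2 := by gcongr
      _ ≤ (t i).card * ∑ j ∈ t i, (|K i j| * ‖f j‖) ^ 2 := sq_sum_le_card_mul_sum_sq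
      _ ≤ D * ∑ j ∈ t i, W ^ 2 * ‖f j‖ ^ 2 := by
          gcongr with j hj
          · exact htc i
          · rw [mul_pow]
            gcongr
            exact hK i j ((hmem i j).1 hj)
      _ = W ^ 2 * D * ∑ j ∈ t i, ‖f j‖ ^ 2 := by rw [← Finset.mul_sum]; ring
  have h2 : ∑ i ∈ F, ∑ j ∈ t i, ‖f j‖ ^ 2 ≤ D * ‖f‖ ^ 2 := by
    have hsw : ∑ i ∈ F, ∑ j ∈ t i, ‖f j‖ ^ 2 =
        ∑ j ∈ F.biUnion t, ∑ i ∈ F.filter (fun i => j ∈ t i), ‖f j‖ ^ 2 := by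
      refine Finset.sum_comm' fun i j => ?_
      simp only [Finset.mem_filter, Finset.mem_biUnion]
      exact ⟨fun h => ⟨h, i, h⟩, fun h => h.1⟩
    rw [hsw]
    calc _ ≤ ∑ j ∈ F.biUnion t, (D : ℝ) * ‖f j‖ ^ 2 := by
          refine Finset.sum_le_sum fun j _ => ?_
          rw [Finset.sum_const, nsmul_eq_mul]
          gcongr
          refine (Finset.card_le_card fun i hi => ?_).trans (htc j)
          rw [Finset.mem_filter, hmem] at hi
          exact (hmem j i).2 ((hs i j).1 hi.2)
      _ = D * ∑ j ∈ F.biUnion t, ‖f j‖ ^ 2 := by rw [Finset.mul_sum]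
      _ ≤ _ := by gcongr; exact sum_norm_sq_le f _
  calc _ ≤ ∑ i ∈ F, W ^ 2 * D * ∑ j ∈ t i, ‖f j‖ ^ 2 := Finset.sum_le_sum fun i _ => h1 i
    _ = W ^ 2 * D * ∑ i ∈ F, ∑ j ∈ t i, ‖f j‖ ^ 2 := by rw [← Finset.mul_sum]
    _ ≤ W ^ 2 * D * (D * ‖f‖ ^ 2) := by gcongr
    _ = _ := by ring

/-- Bounded operator on `ℓ²` given by a linear pointwise formula with a uniform bound. -/
def mkOp {ι : Type*} (T : (ι → ℂ) → ι → ℂ) (c : ℝ) (hc : 0 ≤ c)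
    (hadd : ∀ f g : lp (fun _ : ι => ℂ) 2, T (⇑f + ⇑g) = T f + T g)
    (hsmul : ∀ (a : ℂ) (f : lp (fun _ : ι => ℂ) 2), T (a • ⇑f) = a • T f)
    (hT : ∀ (f : lp (fun _ : ι => ℂ) 2) (F : Finset ι), ∑ i ∈ F, ‖T f i‖ ^ 2 ≤ (c * ‖f‖) ^ 2) :
    lp (fun _ : ι => ℂ) 2 →L[ℂ] lp (fun _ : ι => ℂ) 2 :=
  LinearMap.mkContinuous
    { toFun := fun f => ⟨T f, memℓp_gen' (C := (c * ‖f‖) ^ 2) fun F => by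
        simpa using hT f F⟩
      map_add' := fun f g => by
        ext1
        exact hadd f g
      map_smul' := fun a f => by
        ext1
        exact hsmul a f } c
    fun f => lp.norm_le_of_forall_sum_le (by norm_num) (by positivity) fun F => by
      simpa using hT f F

/-- The weighted adjacency operator `(A_N f)(m) = ∑_{n ∼ m} w(m,n) f(n)`. -/
def adjacencyOp (G : SimpleGraph V) (hG : BoundedDegree G) (M N : ℕ) :
    HilbertN V M N →L[ℂ] HilbertN V M N :=
  mkOp (fun f m => ∑ᶠ n ∈ (particleGraph G M N).neighborSet m, (weight m n : ℂ) * f n)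
    (((M : ℝ) + 1) ^ 2 * (N * hG.choose : ℕ)) (by positivity)
    (fun f g => by
      ext m
      have hfin : ((particleGraph G M N).neighborSet m).Finite :=
        Set.finite_of_encard_le_coe (neighbor_encard_le G hG.choose_spec m)
      simp only [Pi.add_apply, mul_add]
      exact finsum_mem_add_distrib hfin)
    (fun a f => by
      ext m
      have hfin : ((particleGraph G M N).neighborSet m).Finite :=
        Set.finite_of_encard_le_coe (neighbor_encard_le G hG.choose_spec m)
      simp only [Pi.smul_apply, smul_eq_mul]
      rw [finsum_mem_eq_finite_toFinset_sum _ hfin, finsum_mem_eq_finite_toFinset_sum _ hfin,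
        Finset.mul_sum]
      exact Finset.sum_congr rfl fun n _ => by ring)
    (fun f F => schur_bound (fun m => (particleGraph G M N).neighborSet m)
      (fun m n => (particleGraph G M N).adj_comm m n) _
      (neighbor_encard_le G hG.choose_spec) weight _
      (fun m n h => by
        rw [abs_of_nonneg (weight_nonneg m n)]
        exact weight_le G h) f F)

/-- The multiplication operator by the interaction potential. -/
def potentialOp (G : SimpleGraph V) (hG : BoundedDegree G) (M N : ℕ) :
    HilbertN V M N →L[ℂ] HilbertN V M N :=
  mkOp (fun f m => (potential G m : ℂ) * f m) ((N * hG.choose : ℕ) * (M : ℝ) ^ 2) (by positivity)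
    (fun f g => by ext m; simp [mul_add])
    (fun a f => by ext m; simp [mul_left_comm])
    (fun f F => by
      have h : ∀ m : Config V M N, ‖(potential G m : ℂ) * f m‖ ^ 2 ≤
          ((N * hG.choose : ℕ) * (M : ℝ) ^ 2) ^ 2 * ‖f m‖ ^ 2 := by
        intro m
        rw [norm_mul, mul_pow, Complex.norm_real, Real.norm_eq_abs]
        gcongr
        exact potential_bound G hG.choose_spec m
      refine (Finset.sum_le_sum fun m _ => h m).trans ?_
      rw [← Finset.mul_sum, mul_pow _ ‖f‖]
      exact mul_le_mul_of_nonneg_left (sum_norm_sq_le f F) (sq_nonneg _))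

/-- Pointwise formula for the adjacency operator. -/
lemma adjacencyOp_apply (G : SimpleGraph V) (hG : BoundedDegree G) (M N : ℕ)
    (f : HilbertN V M N) (m : Config V M N) :
    adjacencyOp G hG M N f m =
      ∑ᶠ n ∈ (particleGraph G M N).neighborSet m, (weight m n : ℂ) * f n := rfl

/-- Pointwise formula for the potential operator. -/
lemma potentialOp_apply (G : SimpleGraph V) (hG : BoundedDegree G) (M N : ℕ)
    (f : HilbertN V M N) (m : Config V M N) :
    potentialOp G hG M N f m = (potential G m : ℂ) * f m := rfl

/-- The `N`-particle spin-`M/2` XXZ Hamiltonian `H_G^N = -(1/(2Δ)) A_N + V_N`. -/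
def hamiltonian (G : SimpleGraph V) (hG : BoundedDegree G) (M N : ℕ) (Δ : ℝ) :
    HilbertN V M N →L[ℂ] HilbertN V M N :=
  (-(1 / (2 * Δ)) : ℂ) • adjacencyOp G hG M N + potentialOp G hG M N

/-! ### Spectra, direct sums, gaps -/

/-- The real points of the spectrum of a bounded operator (all of it for a self-adjoint one). -/
def realSpectrum {H : Type*} [NormedAddCommGroup H] [NormedSpace ℂ H] (T : H →L[ℂ] H) : Set ℝ :=
  {E | (E : ℂ) ∈ spectrum ℂ T}

/-- The resolvent set of a partially defined operator: `z` such that `T - z` maps its domain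
bijectively onto the space, with bounded inverse `R`. -/
def pmapResolventSet {H : Type*} [NormedAddCommGroup H] [NormedSpace ℂ H] (T : H →ₗ.[ℂ] H) :
    Set ℂ :=
  {z | ∃ R : H →L[ℂ] H,
    (∀ f : H, ∃ h : R f ∈ T.domain, T ⟨R f, h⟩ - z • R f = f) ∧
    (∀ f : T.domain, R (T f - z • (f : H)) = f)}

/-- The real points of the spectrum of a partially defined operator. -/
def pmapRealSpectrum {H : Type*} [NormedAddCommGroup H] [NormedSpace ℂ H] (T : H →ₗ.[ℂ] H) :
    Set ℝ :=
  {E | (E : ℂ) ∉ pmapResolventSet T}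

/-- The direct sum of bounded operators `T i` on the Hilbert sum of the spaces `E i`, with its
maximal domain `{f | ∑ i, ‖T i (f i)‖² < ∞}`. -/
def directSumOp {ι : Type*} (E : ι → Type*) [∀ i, NormedAddCommGroup (E i)]
    [∀ i, NormedSpace ℂ (E i)] (T : ∀ i, E i →L[ℂ] E i) : lp E 2 →ₗ.[ℂ] lp E 2 where
  domain :=
    { carrier := {f | Memℓp (fun i => T i (f i)) 2}
      add_mem' := fun {f g} hf hg => by
        have h := Memℓp.add hf hg
        have e : (fun i => T i ((f + g) i)) =
            (fun i => T i (f i)) + fun i => T i (g i) := by ext i; simp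
        simpa only [Set.mem_ofPred_eq, e] using h
      zero_mem' := by
        have e : (fun i => T i ((0 : lp E 2) i)) = 0 := by ext i; simp
        simpa only [Set.mem_ofPred_eq, e] using zero_memℓp
      smul_mem' := fun c f hf => by
        have h := Memℓp.const_smul hf c
        have e : (fun i => T i ((c • f) i)) = c • fun i => T i (f i) := by ext i; simp
        simpa only [Set.mem_ofPred_eq, e] using h }
  toFun :=
    { toFun := fun f => ⟨fun i => T i (f.1 i), f.2⟩
      map_add' := fun f g => by ext i; simp; rfl
      map_smul' := fun c f => by ext i; simp }

/-- `(lo, hi)` is a spectral gap of a set `σ` of real spectral values: a non-empty open interval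
free of spectrum, with spectrum both below and above it. -/
def IsSpectralGap (σ : Set ℝ) (lo hi : ℝ) : Prop :=
  lo < hi ∧ Disjoint σ (Set.Ioo lo hi) ∧ (σ ∩ Set.Iic lo).Nonempty ∧ (σ ∩ Set.Ici hi).Nonempty

/-- The lowest value of `V_N`. -/
def potentialMin (G : SimpleGraph V) (M N : ℕ) : ℝ :=
  sInf (Set.range fun m : Config V M N => potential G m)

/-- The second lowest value of `V_N`. -/
def potentialSnd (G : SimpleGraph V) (M N : ℕ) : ℝ :=
  sInf ((Set.range fun m : Config V M N => potential G m) \ {potentialMin G M N})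

/-- The droplet spectrum `δ_N = σ(H_G^N) ∩ (0, (1 - M/Δ) V_{N,2})`, where `V_{N,2}` is the second
lowest value of `V_N`. -/
def dropletSpectrum (G : SimpleGraph V) (hG : BoundedDegree G) (M N : ℕ) (Δ : ℝ) : Set ℝ :=
  realSpectrum (hamiltonian G hG M N Δ) ∩ Set.Ioo 0 ((1 - M / Δ) * potentialSnd G M N)

/-! ### The strip -/

/-- The strip of width `L`: `ℤ × {1, …, L}` with nearest-neighbour edges. -/
def strip (L : ℕ) : SimpleGraph (ℤ × Fin L) where
  Adj p q := |p.1 - q.1| + |(p.2 : ℤ) - (q.2 : ℤ)| = 1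
  symm := ⟨fun p q h => by rw [abs_sub_comm q.1, abs_sub_comm (q.2 : ℤ)]; exact h⟩
  loopless := ⟨fun p h => by simp at h⟩

lemma strip_boundedDegree (L : ℕ) : BoundedDegree (strip L) := by
  classical
  refine ⟨9, fun p => ?_⟩
  let F : Finset (ℤ × ℤ) := Finset.Icc (p.1 - 1) (p.1 + 1) ×ˢ
    Finset.Icc ((p.2 : ℤ) - 1) ((p.2 : ℤ) + 1)
  have hinj : Function.Injective fun q : ℤ × Fin L => (q.1, (q.2 : ℤ)) := by
    rintro ⟨a, b⟩ ⟨c, d⟩ h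
    simp only [Prod.mk.injEq, Nat.cast_inj] at h
    exact Prod.ext h.1 (Fin.ext h.2)
  rw [← hinj.encard_image]
  have hsub : (fun q : ℤ × Fin L => (q.1, (q.2 : ℤ))) '' (strip L).neighborSet p ⊆
      (F : Set (ℤ × ℤ)) := by
    rintro _ ⟨q, hq, rfl⟩
    have hq' : |p.1 - q.1| + |(p.2 : ℤ) - (q.2 : ℤ)| = 1 := hq
    have h1 := abs_nonneg (p.1 - q.1)
    have h2 := abs_nonneg ((p.2 : ℤ) - (q.2 : ℤ))
    have h3 := abs_le.1 (show |p.1 - q.1| ≤ 1 by linarith)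
    have h4 := abs_le.1 (show |(p.2 : ℤ) - (q.2 : ℤ)| ≤ 1 by linarith)
    simp only [F, Finset.coe_product, Finset.coe_Icc, Set.mem_prod, Set.mem_Icc]
    omega
  refine (Set.encard_le_encard hsub).trans ?_
  rw [Set.encard_coe_eq_coe_finsetCard]
  have hc : F.card = 9 := by
    simp only [F, Finset.card_product, Int.card_Icc]
    rw [show p.1 + 1 + 1 - (p.1 - 1) = 3 by ring,
      show (p.2 : ℤ) + 1 + 1 - ((p.2 : ℤ) - 1) = 3 by ring]
    rfl
  rw [hc]

/-- The `N`-particle XXZ Hamiltonian on the strip of width `L`. -/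
def stripHamiltonian (L M N : ℕ) (Δ : ℝ) :
    HilbertN (ℤ × Fin L) M N →L[ℂ] HilbertN (ℤ × Fin L) M N :=
  hamiltonian (strip L) (strip_boundedDegree L) M N Δ

/-- The particle numbers `S = {k L M : k ∈ ℕ, k ≥ L/2}`. -/
def stripNumbers (L M : ℕ) : Set ℕ := {N | ∃ k : ℕ, (L : ℝ) / 2 ≤ k ∧ N = k * L * M}

/-- The restricted Hamiltonian `Ĥ = ⨁_{N ∈ S} H_G^N` on the strip. -/
def restrictedHamiltonian (L M : ℕ) (Δ : ℝ) :
    lp (fun N : stripNumbers L M => HilbertN (ℤ × Fin L) M N) 2 →ₗ.[ℂ]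
      lp (fun N : stripNumbers L M => HilbertN (ℤ × Fin L) M N) 2 :=
  directSumOp _ fun N => stripHamiltonian L M N Δ

end XXZ

end

/-! The choice is `E_- = LM²` and `E_+ = (1 - M/Δ)(LM² + 1)`, so the error terms vanish. The
argument combines a discrete variational problem for the potential with a block estimate for the
Hamiltonian.

Twice the potential is an integer quadratic form, the energy `M ∑ deg(x) m(x) - ∑ m(x) m(y)` over
ordered adjacent pairs. For `kLM` particles with `k ≥ L/2` it is either equal to `2LM²` or at least
`2LM² + 2` (`energy_eq_or_ge`). On a configuration with values `0` and `M` only, it is `M²` times an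
edge perimeter, and the isoperimetric inequality of the strip applies. In general, along a transport
of particles between two non-adjacent sites the energy is affine, so one direction does not raise
it. As the strip has no triangles, this leaves at most two partially filled sites, and those are
treated by the identity for the perimeters of `S ∪ {x}` and `S ∪ {y}`.

Two minimizers are never adjacent. If `m` and `n` differ by one hop, then `m + n`, with at most `2M`
particles per site, has energy `2E(m) + 2E(n) - 2`. For minimizers this is `8LM² - 2`, below the
minimum `2L(2M)²` for the capacity `2M` (`strip_minimizers_not_adj`).

The weight of a hop is the geometric mean of its forward and backward rates, and the rates out of
`m` add up to at most `2V(m)`. Hence `|⟨Af, f⟩| ≤ 2⟨Vf, f⟩` and `H ≥ (1 - 1/Δ)V` as forms. Let `P`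
project to the minimizers. The form of `H` is exactly `LM²` on the range of `P`, and at least `(1 -
1/Δ)(LM² + 1)` on its complement. Multiplying `H - E` by the unitary `1 - 2P` makes its real part
positive for `E` strictly between these values, whatever the off-diagonal blocks are
(`exists_resolvent`). The resulting resolvent bound does not depend on `N`, and so passes to the
direct sum. -/

noncomputable section

namespace XXZ

open Classical Finset Filter Topology

/-! ### Integer energy and perimeter on a graph -/

section Energy

variable {V : Type*} (G : SimpleGraph V)

/-- The adjacency matrix with integer entries. -/
def adjInd (x y : V) : ℤ := if G.Adj x y then 1 else 0

lemma adjInd_comm (x y : V) : adjInd G x y = adjInd G y x := by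
  simp [adjInd, G.adj_comm]

lemma adjInd_self (x : V) : adjInd G x x = 0 := by simp [adjInd]

/-- The degree of a vertex, as an integer. -/
def degZ (x : V) : ℤ := (G.neighborSet x).ncard

/-- The adjacency form `∑ m(x) n(y)` over ordered adjacent pairs in `F`. -/
def adjForm (F : Finset V) (m n : V → ℤ) : ℤ := ∑ x ∈ F, ∑ y ∈ F, adjInd G x y * (m x * n y)

/-- Twice the interaction potential of a configuration supported in `F`. -/
def energy (M : ℤ) (F : Finset V) (m : V → ℤ) : ℤ :=
  M * ∑ x ∈ F, degZ G x * m x - adjForm G F m m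

lemma adjForm_comm (F : Finset V) (m n : V → ℤ) : adjForm G F m n = adjForm G F n m := by
  unfold adjForm
  rw [Finset.sum_comm]
  refine Finset.sum_congr rfl fun x _ => Finset.sum_congr rfl fun y _ => ?_
  rw [adjInd_comm]
  ring

lemma adjForm_add_left (F : Finset V) (m m' n : V → ℤ) :
    adjForm G F (m + m') n = adjForm G F m n + adjForm G F m' n := by
  simp only [adjForm, ← Finset.sum_add_distrib, Pi.add_apply]
  refine Finset.sum_congr rfl fun x _ => Finset.sum_congr rfl fun y _ => ?_
  ring

lemma adjForm_smul_left (F : Finset V) (c : ℤ) (m n : V → ℤ) :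
    adjForm G F (c • m) n = c * adjForm G F m n := by
  simp only [adjForm, Finset.mul_sum, Pi.smul_apply, smul_eq_mul]
  refine Finset.sum_congr rfl fun x _ => Finset.sum_congr rfl fun y _ => ?_
  ring

lemma adjForm_add_right (F : Finset V) (m n n' : V → ℤ) :
    adjForm G F m (n + n') = adjForm G F m n + adjForm G F m n' := by
  rw [adjForm_comm, adjForm_add_left, adjForm_comm G F n, adjForm_comm G F n']

lemma adjForm_smul_right (F : Finset V) (c : ℤ) (m n : V → ℤ) :
    adjForm G F m (c • n) = c * adjForm G F m n := by
  rw [adjForm_comm, adjForm_smul_left, adjForm_comm]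

lemma adjForm_single [DecidableEq V] (F : Finset V) {x y : V} (hx : x ∈ F) (hy : y ∈ F) :
    adjForm G F (Pi.single x 1) (Pi.single y 1) = adjInd G x y := by
  simp [adjForm, Pi.single_apply, hx, hy]

/-- Modulo 2 the terms of `(x, y)` and `(y, x)` cancel, and the diagonal vanishes for lack of loops.
-/
lemma even_adjForm_self (F : Finset V) (m : V → ℤ) : Even (adjForm G F m m) := by
  rw [even_iff_two_dvd]
  refine (ZMod.intCast_zmod_eq_zero_iff_dvd _ 2).1 ?_
  unfold adjForm
  rw [← Finset.sum_product', Int.cast_sum]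
  refine Finset.sum_involution (fun p _ => (p.2, p.1)) ?_ ?_ ?_ ?_
  · rintro ⟨x, y⟩ -
    dsimp only
    rw [adjInd_comm G y x, mul_comm (m y)]
    exact CharTwo.add_self_eq_zero _
  · rintro ⟨x, y⟩ - h heq
    rw [Prod.mk.injEq] at heq
    apply h
    dsimp only
    obtain rfl : y = x := heq.1
    rw [adjInd_self]
    simp
  · rintro ⟨x, y⟩ h
    simpa [and_comm] using h
  · rintro ⟨x, y⟩ -
    rfl

/-- The linear part of the energy. -/
def degSum (F : Finset V) (m : V → ℤ) : ℤ := ∑ x ∈ F, degZ G x * m x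

lemma degSum_add (F : Finset V) (m n : V → ℤ) :
    degSum G F (m + n) = degSum G F m + degSum G F n := by
  simp only [degSum, ← Finset.sum_add_distrib, Pi.add_apply, mul_add]

lemma degSum_smul (F : Finset V) (c : ℤ) (m : V → ℤ) :
    degSum G F (c • m) = c * degSum G F m := by
  simp only [degSum, Finset.mul_sum, Pi.smul_apply, smul_eq_mul]
  exact Finset.sum_congr rfl fun x _ => by ring

lemma energy_eq (M : ℤ) (F : Finset V) (m : V → ℤ) :
    energy G M F m = M * degSum G F m - adjForm G F m m := rfl

/-- The perimeter of a finite set of vertices. -/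
def perimeter (S : Finset V) : ℤ := ∑ x ∈ S, degZ G x - ∑ x ∈ S, ∑ y ∈ S, adjInd G x y

/-- The bridge from the potential to isoperimetry. -/
lemma energy_indicator [DecidableEq V] (M : ℤ) {S F : Finset V} (h : S ⊆ F) :
    energy G M F (fun x => if x ∈ S then M else 0) = M ^ 2 * perimeter G S := by
  have h1 : ∀ f : V → ℤ, ∑ x ∈ F, (if x ∈ S then f x else 0) = ∑ x ∈ S, f x := by
    intro f
    rw [← Finset.sum_filter, Finset.filter_mem_eq_inter, Finset.inter_eq_right.2 h]
  have h2 : adjForm G F (fun x => if x ∈ S then M else 0) (fun x => if x ∈ S then M else 0) =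
      M ^ 2 * ∑ x ∈ S, ∑ y ∈ S, adjInd G x y := by
    unfold adjForm
    rw [Finset.mul_sum, ← h1]
    refine Finset.sum_congr rfl fun x _ => ?_
    dsimp only
    split_ifs with hx
    · rw [Finset.mul_sum, ← h1]
      refine Finset.sum_congr rfl fun y _ => ?_
      split_ifs <;> ring
    · simp
  have h3 : degSum G F (fun x => if x ∈ S then M else 0) = M * ∑ x ∈ S, degZ G x := by
    unfold degSum
    rw [Finset.mul_sum, ← h1]
    refine Finset.sum_congr rfl fun x _ => ?_
    dsimp only
    split_ifs <;> ring
  rw [energy_eq, h2, h3, perimeter]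
  ring

/-- The perimeter counts the ordered boundary edges. -/
lemma exists_perimeter_eq_card (hG : ∀ x, (G.neighborSet x).Finite) (S : Finset V) :
    ∃ D : Finset (V × V), (∀ x y, (x, y) ∈ D ↔ x ∈ S ∧ y ∉ S ∧ G.Adj x y) ∧
      perimeter G S = D.card := by
  set U := S.biUnion fun x => (hG x).toFinset with hU
  have hmem : ∀ x ∈ S, ∀ y, G.Adj x y → y ∈ U := by
    intro x hx y h
    rw [hU, Finset.mem_biUnion]
    exact ⟨x, hx, by simpa using h⟩
  refine ⟨(S ×ˢ U).filter fun p => p.2 ∉ S ∧ G.Adj p.1 p.2, fun x y => ?_, ?_⟩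
  · simp only [Finset.mem_filter, Finset.mem_product]
    exact ⟨fun h => ⟨h.1.1, h.2⟩, fun h => ⟨⟨h.1, hmem x h.1 y h.2.2⟩, h.2⟩⟩
  rw [Finset.card_filter, Finset.sum_product, Nat.cast_sum, perimeter, ← Finset.sum_sub_distrib]
  refine Finset.sum_congr rfl fun x hx => ?_
  have h1 : degZ G x = ((U.filter fun y => G.Adj x y).card : ℤ) := by
    rw [degZ, ← Set.ncard_coe_finset]
    congr 2
    ext y
    simp only [SimpleGraph.mem_neighborSet, Finset.coe_filter, Set.mem_ofPred_eq]
    exact ⟨fun h => ⟨hmem x hx y h, h⟩, fun h => h.2⟩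
  have h2 : ∑ y ∈ S, adjInd G x y = ((U.filter fun y => y ∈ S ∧ G.Adj x y).card : ℤ) := by
    simp only [adjInd]
    rw [Finset.sum_boole]
    congr 2
    ext y
    simp only [Finset.mem_filter]
    exact ⟨fun h => ⟨hmem x hx y h.2, h⟩, fun h => h.2⟩
  rw [h1, h2, ← Finset.card_filter, sub_eq_iff_eq_add, ← Nat.cast_add, add_comm,
    ← Finset.card_union_of_disjoint]
  · congr 2
    ext y
    simp only [Finset.mem_filter, Finset.mem_union]
    tauto
  · rw [Finset.disjoint_filter]
    tauto

end Energy

/-! ### The isoperimetric inequality in the strip -/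

lemma strip_neighborSet_finite (L : ℕ) (x : ℤ × Fin L) : ((strip L).neighborSet x).Finite :=
  Set.finite_of_encard_le_coe ((strip_boundedDegree L).choose_spec x)

lemma strip_adj_right {L : ℕ} (z : ℤ) (l : Fin L) : (strip L).Adj (z, l) (z + 1, l) := by
  simp [strip]

lemma strip_adj_left {L : ℕ} (z : ℤ) (l : Fin L) : (strip L).Adj (z, l) (z - 1, l) := by
  simp [strip]

/-- Membership propagates along a column unless some vertical edge is a boundary edge. -/
lemma strip_column_full {L : ℕ} {P : Fin L → Prop}
    (h : ∀ l l' : Fin L, (l : ℕ) + 1 = l' → (P l ↔ P l')) (hP : ∃ l, P l) (l : Fin L) : P l := by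
  obtain ⟨l₀, h₀⟩ := hP
  have key : ∀ n (hn : n < L), P ⟨n, hn⟩ ↔ P ⟨0, by omega⟩ := by
    intro n
    induction n with
    | zero => intro hn; rfl
    | succ n ih =>
      intro hn
      rw [← ih (by omega)]
      exact (h ⟨n, by omega⟩ ⟨n + 1, hn⟩ rfl).symm
  exact (key l l.2).2 ((key l₀ l₀.2).1 h₀)

/-- Every nonempty row contributes two horizontal boundary edges, and every column that is neither
empty nor full contributes a vertical one. -/
lemma strip_perimeter_ge {L : ℕ} (S : Finset (ℤ × Fin L)) :
    2 * ((S.image Prod.snd).card : ℤ) +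
      ((S.image Prod.fst).filter fun z => ∃ l, (z, l) ∉ S).card ≤ perimeter (strip L) S := by
  obtain ⟨D, hmem, hD⟩ := exists_perimeter_eq_card _ (strip_neighborSet_finite L) S
  rw [hD]
  set Dr := D.filter fun p => p.2.1 = p.1.1 + 1
  set Dl := D.filter fun p => p.2.1 = p.1.1 - 1
  set Dv := D.filter fun p => p.2.1 = p.1.1
  have hr : (S.image Prod.snd).card ≤ Dr.card := by
    refine le_trans (Finset.card_le_card ?_) (Finset.card_image_le (s := Dr) (f := fun p => p.1.2))
    intro l hl
    obtain ⟨p, hp, rfl⟩ := Finset.mem_image.1 hl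
    obtain ⟨q, hq, hmax⟩ := Finset.exists_max_image (S.filter fun q => q.2 = p.2) Prod.fst
      ⟨p, by simp [hp]⟩
    rw [Finset.mem_filter] at hq
    refine Finset.mem_image.2 ⟨(q, (q.1 + 1, q.2)), ?_, hq.2⟩
    refine Finset.mem_filter.2 ⟨(hmem _ _).2 ⟨hq.1, fun hc => ?_, strip_adj_right q.1 q.2⟩, rfl⟩
    have := hmax (q.1 + 1, q.2) (Finset.mem_filter.2 ⟨hc, hq.2⟩)
    simp at this
  have hl : (S.image Prod.snd).card ≤ Dl.card := by
    refine le_trans (Finset.card_le_card ?_) (Finset.card_image_le (s := Dl) (f := fun p => p.1.2))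
    intro l hl
    obtain ⟨p, hp, rfl⟩ := Finset.mem_image.1 hl
    obtain ⟨q, hq, hmin⟩ := Finset.exists_min_image (S.filter fun q => q.2 = p.2) Prod.fst
      ⟨p, by simp [hp]⟩
    rw [Finset.mem_filter] at hq
    refine Finset.mem_image.2 ⟨(q, (q.1 - 1, q.2)), ?_, hq.2⟩
    refine Finset.mem_filter.2 ⟨(hmem _ _).2 ⟨hq.1, fun hc => ?_, strip_adj_left q.1 q.2⟩, rfl⟩
    have := hmin (q.1 - 1, q.2) (Finset.mem_filter.2 ⟨hc, hq.2⟩)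
    simp at this
  have hv : ((S.image Prod.fst).filter fun z => ∃ l, (z, l) ∉ S).card ≤ Dv.card := by
    refine le_trans (Finset.card_le_card ?_) (Finset.card_image_le (s := Dv) (f := fun p => p.1.1))
    intro z hz
    rw [Finset.mem_filter, Finset.mem_image] at hz
    obtain ⟨⟨⟨z', l₀⟩, hp, rfl⟩, l₁, hl₁⟩ := hz
    by_contra hcon
    refine hl₁ (strip_column_full (P := fun l => (z', l) ∈ S) ?_ ⟨l₀, hp⟩ l₁)
    have hcl : ∀ l l' : Fin L, (strip L).Adj (z', l) (z', l') → (z', l) ∈ S → (z', l') ∈ S := by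
      intro l l' ha h1
      by_contra h2
      exact hcon (Finset.mem_image.2 ⟨((z', l), (z', l')),
        Finset.mem_filter.2 ⟨(hmem _ _).2 ⟨h1, h2, ha⟩, rfl⟩, rfl⟩)
    intro l l' hll
    have ha : (strip L).Adj (z', l) (z', l') := by
      simp only [strip, ← hll]
      push_cast
      simp
    exact ⟨hcl l l' ha, hcl l' l ha.symm⟩
  have hsum : Dr.card + Dl.card + Dv.card ≤ D.card := by
    rw [← Finset.card_union_of_disjoint, ← Finset.card_union_of_disjoint]
    · refine Finset.card_le_card ?_
      refine Finset.union_subset (Finset.union_subset ?_ ?_) ?_ <;> exact Finset.filter_subset _ _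
    · rw [Finset.disjoint_left]
      intro p hp hp'
      simp only [Dr, Dl, Dv, Finset.mem_union, Finset.mem_filter] at hp hp'
      omega
    · rw [Finset.disjoint_left]
      intro p hp hp'
      simp only [Dr, Dl, Finset.mem_filter] at hp hp'
      omega
  have : 2 * (S.image Prod.snd).card +
      ((S.image Prod.fst).filter fun z => ∃ l, (z, l) ∉ S).card ≤ D.card := by omega
  exact_mod_cast this

/-- Isoperimetric alternative in the strip: a set with a full column has perimeter at least `2L`,
and more if its columns are not all full; any other set obeys the quadratic inequality of a quadrant. -/
lemma strip_isoperimetric {L : ℕ} (S : Finset (ℤ × Fin L)) :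
    (2 * (L : ℤ) ≤ perimeter (strip L) S ∧
      (¬ L ∣ S.card → 2 * (L : ℤ) + 1 ≤ perimeter (strip L) S)) ∨
    8 * (S.card : ℤ) ≤ perimeter (strip L) S ^ 2 ∧ 0 ≤ perimeter (strip L) S := by
  have h := strip_perimeter_ge S
  set W := S.image Prod.fst with hW
  set R := S.image Prod.snd with hR
  by_cases hf : ∃ z ∈ W, ∀ l, (z, l) ∈ S
  · left
    obtain ⟨z, -, hz⟩ := hf
    have hRc : R.card = L := by
      have : R = Finset.univ := Finset.eq_univ_of_forall fun l =>
        Finset.mem_image.2 ⟨(z, l), hz l, rfl⟩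
      rw [this]
      simp
    rw [hRc] at h
    refine ⟨by linarith [Nat.cast_nonneg (α := ℤ) (W.filter fun z => ∃ l, (z, l) ∉ S).card],
      fun hd => ?_⟩
    have hne : 1 ≤ (W.filter fun z => ∃ l, (z, l) ∉ S).card := by
      rw [Nat.one_le_iff_ne_zero, Finset.card_ne_zero]
      by_contra hcon
      rw [Finset.not_nonempty_iff_eq_empty, Finset.filter_eq_empty_iff] at hcon
      push Not at hcon
      apply hd
      have hS : S = W ×ˢ (Finset.univ : Finset (Fin L)) := by
        ext ⟨a, b⟩
        simp only [Finset.mem_product, Finset.mem_univ, and_true]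
        exact ⟨fun h => Finset.mem_image.2 ⟨_, h, rfl⟩, fun h => hcon h b⟩
      rw [hS, Finset.card_product]
      simp
    have : (1 : ℤ) ≤ (W.filter fun z => ∃ l, (z, l) ∉ S).card := by exact_mod_cast hne
    linarith
  · right
    push Not at hf
    rw [Finset.filter_true_of_mem hf] at h
    have hS : S.card ≤ W.card * R.card := by
      rw [← Finset.card_product]
      refine Finset.card_le_card fun p hp => Finset.mem_product.2
        ⟨Finset.mem_image.2 ⟨p, hp, rfl⟩, Finset.mem_image.2 ⟨p, hp, rfl⟩⟩
    have hS' : (S.card : ℤ) ≤ W.card * R.card := by exact_mod_cast hS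
    have h1 : (0 : ℤ) ≤ W.card := Nat.cast_nonneg _
    have h2 : (0 : ℤ) ≤ R.card := Nat.cast_nonneg _
    refine ⟨?_, by linarith⟩
    -- The perimeter is at least `2|R| + |W|`, and `(2|R| + |W|)² ≥ 8|R||W| ≥ 8|S|`.
    have h3 : (2 * (R.card : ℤ) + W.card) ^ 2 ≤ perimeter (strip L) S ^ 2 :=
      pow_le_pow_left₀ (by positivity) h 2
    nlinarith [sq_nonneg (2 * (R.card : ℤ) - W.card)]

/-- This is where `k ≥ L/2` enters: without a full column the squared perimeter is at least `8kL ≥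
(2L)²`. -/
lemma strip_perimeter_mul {L k : ℕ} (hk : L ≤ 2 * k) {S : Finset (ℤ × Fin L)}
    (hS : S.card = k * L) : 2 * (L : ℤ) ≤ perimeter (strip L) S := by
  rcases strip_isoperimetric S with h | ⟨h, h0⟩
  · exact h.1
  · have hk' : (L : ℤ) ≤ 2 * k := by exact_mod_cast hk
    rw [hS] at h
    push_cast at h
    have : 0 ≤ (L : ℤ) := Nat.cast_nonneg _
    refine abs_le_of_sq_le_sq' (a := 2 * (L : ℤ)) ?_ h0 |>.2
    nlinarith

/-- As `L ≥ 2` does not divide `kL + 1`, the columns cannot all be full or empty; without a full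
column, `8(kL + 1) > (2L)²`. -/
lemma strip_perimeter_succ {L k : ℕ} (hL : 2 ≤ L) (hk : L ≤ 2 * k) {S : Finset (ℤ × Fin L)}
    (hS : S.card = k * L + 1) : 2 * (L : ℤ) + 1 ≤ perimeter (strip L) S := by
  rcases strip_isoperimetric S with h | ⟨h, h0⟩
  · refine h.2 fun hd => ?_
    rw [hS, Nat.dvd_add_right (Dvd.intro_left k rfl), Nat.dvd_one] at hd
    omega
  · have hk' : (L : ℤ) ≤ 2 * k := by exact_mod_cast hk
    rw [hS] at h
    push_cast at h
    by_contra hcon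
    have h1 : perimeter (strip L) S ≤ 2 * L := by linarith
    nlinarith [pow_le_pow_left₀ h0 h1 2]

/-- The bounds follow from `8(kL - 1) > (2L - 2)²` and, outside the exception, `8(kL - 1) > (2L -
1)²`. The exception is genuine: for `L = 2`, `k = 1` the set is a single site, of perimeter `3`. -/
lemma strip_perimeter_pred {L k : ℕ} (hL : 2 ≤ L) (hk : L ≤ 2 * k) {S : Finset (ℤ × Fin L)}
    (hS : S.card + 1 = k * L) : 2 * (L : ℤ) - 1 ≤ perimeter (strip L) S ∧
      (¬ (L = 2 ∧ k = 1) → 2 * (L : ℤ) ≤ perimeter (strip L) S) := by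
  rcases strip_isoperimetric S with h | ⟨h, h0⟩
  · exact ⟨by linarith [h.1], fun _ => h.1⟩
  · have hk' : (L : ℤ) ≤ 2 * k := by exact_mod_cast hk
    have hL' : (2 : ℤ) ≤ L := by exact_mod_cast hL
    have hS' : (S.card : ℤ) + 1 = k * L := by exact_mod_cast hS
    constructor
    · by_contra hcon
      have h1 : perimeter (strip L) S ≤ 2 * L - 2 := by linarith
      nlinarith [pow_le_pow_left₀ h0 h1 2]
    · intro hne
      by_contra hcon
      have h1 : perimeter (strip L) S ≤ 2 * L - 1 := by linarith
      have h2 := pow_le_pow_left₀ h0 h1 2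
      rcases Nat.lt_or_ge 2 L with h3 | h3
      · have h3' : (3 : ℤ) ≤ L := by exact_mod_cast h3
        nlinarith
      · obtain rfl : L = 2 := le_antisymm h3 hL
        have : (2 : ℤ) ≤ k := by
          have : 2 ≤ k := by omega
          exact_mod_cast this
        push_cast at *
        nlinarith

/-! ### Transport of particles between sites -/

section Pushing

variable {V : Type*} (G : SimpleGraph V)

lemma energy_congr (M : ℤ) {F : Finset V} {m n : V → ℤ} (h : ∀ x ∈ F, m x = n x) :
    energy G M F m = energy G M F n := by
  have h1 : degSum G F m = degSum G F n := Finset.sum_congr rfl fun x hx => by rw [h x hx]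
  have h2 : adjForm G F m m = adjForm G F n n := Finset.sum_congr rfl fun x hx =>
    Finset.sum_congr rfl fun y hy => by rw [h x hx, h y hy]
  rw [energy_eq, energy_eq, h1, h2]

/-- For `d = e_x - e_y` the quadratic term is `2t²` times the adjacency of `x` and `y`, so the
energy is affine in `t` when they are not adjacent. -/
lemma energy_add_smul (M : ℤ) (F : Finset V) (m d : V → ℤ) (t : ℤ) :
    energy G M F (m + t • d) = energy G M F m +
      t * (M * degSum G F d - 2 * adjForm G F m d) - t ^ 2 * adjForm G F d d := by
  simp only [energy_eq, degSum_add, degSum_smul, adjForm_add_left, adjForm_add_right,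
    adjForm_smul_left, adjForm_smul_right]
  rw [adjForm_comm G F d m]
  ring

/-- The sites of `F` whose occupation is neither minimal nor maximal. -/
def fracSites (M : ℤ) (F : Finset V) (m : V → ℤ) : Finset V := F.filter fun x => 0 < m x ∧ m x < M

/-- The sites of `F` with maximal occupation. -/
def fullSites (M : ℤ) (F : Finset V) (m : V → ℤ) : Finset V := F.filter fun x => m x = M

/-- If `M` divides the particle number, it therefore divides the number of particles on the
fractional sites. -/
lemma sum_eq_full_add_frac {M : ℤ} {F : Finset V} {m : V → ℤ}
    (hm : ∀ x ∈ F, 0 ≤ m x ∧ m x ≤ M) :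
    ∑ x ∈ F, m x = M * (fullSites M F m).card + ∑ x ∈ fracSites M F m, m x := by
  have h1 : M * ((fullSites M F m).card : ℤ) = ∑ x ∈ F, if m x = M then M else 0 := by
    rw [← Finset.sum_filter, Finset.sum_const, nsmul_eq_mul, mul_comm]
    rfl
  rw [h1, fracSites, Finset.sum_filter, ← Finset.sum_add_distrib]
  refine Finset.sum_congr rfl fun x hx => ?_
  have := hm x hx
  split_ifs <;> omega

variable [DecidableEq V]

/-- The configuration `e_x - e_y`. -/
def hop (x y : V) : V → ℤ := Pi.single x 1 - Pi.single y 1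

lemma hop_eq (x y : V) : hop x y = Pi.single x 1 + (-1 : ℤ) • Pi.single y 1 := by
  rw [hop, sub_eq_add_neg, neg_one_smul]

lemma hop_swap (x y : V) : hop y x = (-1 : ℤ) • hop x y := by
  simp [hop]

lemma adjForm_hop {F : Finset V} {x y : V} (hx : x ∈ F) (hy : y ∈ F) :
    adjForm G F (hop x y) (hop x y) = -2 * adjInd G x y := by
  rw [hop_eq]
  simp only [adjForm_add_left, adjForm_add_right, adjForm_smul_left, adjForm_smul_right]
  rw [adjForm_single G F hx hx, adjForm_single G F hx hy, adjForm_single G F hy hx,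
    adjForm_single G F hy hy, adjInd_self, adjInd_self, adjInd_comm G y x]
  ring

lemma hop_apply_left {x y : V} (h : x ≠ y) : hop x y x = 1 := by
  simp [hop, h]

lemma hop_apply_right {x y : V} (h : x ≠ y) : hop x y y = -1 := by
  simp [hop, h.symm]

lemma hop_apply_of_ne {x y z : V} (hx : z ≠ x) (hy : z ≠ y) : hop x y z = 0 := by
  simp [hop, hx, hy]

lemma sum_hop {F : Finset V} {x y : V} (hx : x ∈ F) (hy : y ∈ F) : ∑ z ∈ F, hop x y z = 0 := by
  simp [hop, Pi.single_apply, hx, hy]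

/-- Particles can be transported between two non-adjacent fractional sites, in one of the two
directions, without raising the energy, until one of the two sites is no longer fractional. -/
lemma exists_push {M : ℤ} {F : Finset V} {m : V → ℤ} (hm : ∀ x ∈ F, 0 ≤ m x ∧ m x ≤ M)
    {x y : V} (hx : x ∈ fracSites M F m) (hy : y ∈ fracSites M F m) (hxy : x ≠ y)
    (hadj : ¬ G.Adj x y) :
    ∃ m' : V → ℤ, (∀ x ∈ F, 0 ≤ m' x ∧ m' x ≤ M) ∧ ∑ z ∈ F, m' z = ∑ z ∈ F, m z ∧
      energy G M F m' ≤ energy G M F m ∧ (fracSites M F m').card < (fracSites M F m).card ∧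
      fracSites M F m \ {x, y} ⊆ fracSites M F m' := by
  -- Exchanging `x` and `y` changes the sign of the slope, so it may be taken non-positive.
  wlog hs : M * degSum G F (hop x y) - 2 * adjForm G F m (hop x y) ≤ 0 generalizing x y
  · obtain ⟨m', h⟩ := this hy hx hxy.symm (fun h => hadj h.symm) (by
      rw [hop_swap, degSum_smul, adjForm_smul_right]
      linarith)
    exact ⟨m', by rwa [Finset.pair_comm x y]⟩
  simp only [fracSites, Finset.mem_filter] at hx hy
  -- The largest transport from `y` to `x`: it fills `x` or empties `y`.
  set t := min (M - m x) (m y) with ht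
  have ht0 : 0 < t := by omega
  have hvx : (m + t • hop x y) x = m x + t := by simp [hop_apply_left hxy]
  have hvy : (m + t • hop x y) y = m y - t := by simp [hop_apply_right hxy, sub_eq_add_neg]
  have hvz : ∀ z, z ≠ x → z ≠ y → (m + t • hop x y) z = m z := fun z h1 h2 => by
    simp [hop_apply_of_ne h1 h2]
  refine ⟨m + t • hop x y, fun z hz => ?_, ?_, ?_, ?_, ?_⟩
  · by_cases h1 : z = x
    · rw [h1, hvx]; omega
    by_cases h2 : z = y
    · rw [h2, hvy]; omega
    rw [hvz z h1 h2]
    exact hm z hz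
  · simp only [Pi.add_apply, Finset.sum_add_distrib, Pi.smul_apply, smul_eq_mul]
    rw [← Finset.mul_sum, sum_hop hx.1 hy.1]
    ring
  · rw [energy_add_smul, adjForm_hop G hx.1 hy.1, adjInd, if_neg hadj]
    nlinarith
  · refine Finset.card_lt_card (Finset.ssubset_iff_subset_ne.2 ⟨?_, ?_⟩)
    · intro z hz
      simp only [fracSites, Finset.mem_filter] at hz ⊢
      by_cases h1 : z = x
      · rw [h1]; exact hx
      by_cases h2 : z = y
      · rw [h2]; exact hy
      rwa [hvz z h1 h2] at hz
    · intro heq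
      have h1 : x ∈ fracSites M F m := Finset.mem_filter.2 hx
      have h2 : y ∈ fracSites M F m := Finset.mem_filter.2 hy
      rw [← heq] at h1 h2
      simp only [fracSites, Finset.mem_filter, hvx, hvy] at h1 h2
      omega
  · intro z hz
    simp only [fracSites, Finset.mem_sdiff, Finset.mem_filter, Finset.mem_insert,
      Finset.mem_singleton, not_or] at hz ⊢
    rw [hvz z hz.2.1 hz.2.2]
    exact hz.1

lemma perimeter_insert {S : Finset V} {x : V} (hx : x ∉ S) :
    perimeter G (insert x S) = perimeter G S + (degZ G x - 2 * ∑ y ∈ S, adjInd G x y) := by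
  simp only [perimeter, Finset.sum_insert hx, Finset.sum_add_distrib, adjInd_self]
  rw [Finset.sum_congr rfl fun y _ => adjInd_comm G y x]
  ring

/-- Supermodularity defect of the perimeter. -/
lemma perimeter_insert_insert {S : Finset V} {x y : V} (hx : x ∉ S) (hy : y ∉ S) (hxy : x ≠ y) :
    perimeter G (insert x S) + perimeter G (insert y S) =
      perimeter G S + perimeter G (insert x (insert y S)) + 2 * adjInd G x y := by
  have h : x ∉ insert y S := by simp [hx, hxy]
  rw [perimeter_insert G h, perimeter_insert G hx, perimeter_insert G hy, Finset.sum_insert hy]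
  ring

/-- Because `a + b = M`, the energy interpolates between those of the full sets `S ∪ {x}` and `S ∪
{y}`, up to the interaction of `x` with `y`. -/
lemma energy_indicator_add_single (M : ℤ) {F S : Finset V} (hS : S ⊆ F) {x y : V} (hx : x ∈ F)
    (hy : y ∈ F) (hxS : x ∉ S) (hyS : y ∉ S) (a b : ℤ) (hab : a + b = M) :
    energy G M F ((fun z => if z ∈ S then M else 0) + a • Pi.single x 1 + b • Pi.single y 1) =
      a * M * perimeter G (insert x S) + b * M * perimeter G (insert y S) -
        2 * a * b * adjInd G x y := by
  have hdeg : ∀ w ∈ F, degSum G F (Pi.single w 1) = degZ G w := fun w hw => by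
    simp [degSum, Pi.single_apply, hw]
  have hadj : ∀ w ∈ F, adjForm G F (fun z => if z ∈ S then M else 0) (Pi.single w 1) =
      M * ∑ z ∈ S, adjInd G w z := fun w hw => by
    rw [adjForm_comm, adjForm]
    simp only [Pi.single_apply]
    rw [Finset.sum_eq_single_of_mem w hw fun u _ hu => by simp [hu], Finset.mul_sum,
      ← Finset.sum_subset hS fun u _ hu => by simp [hu]]
    refine Finset.sum_congr rfl fun z hz => ?_
    simp [hz, mul_comm]
  rw [energy_add_smul, energy_add_smul, energy_indicator G M hS, adjForm_add_left,
    adjForm_smul_left, hdeg x hx, hdeg y hy, hadj x hx, hadj y hy, adjForm_single G F hx hx,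
    adjForm_single G F hx hy, adjForm_single G F hy hy, adjInd_self, adjInd_self,
    perimeter_insert G hxS, perimeter_insert G hyS, ← hab]
  ring

end Pushing

/-- Here `j` and `M - j` are the occupations of the two fractional sites, `a` is their adjacency,
and `α`, `β` are the excesses over `2L` of the perimeters obtained by filling one of them. For `a =
1`, either both excesses are at least `1` and `M² ≥ 2j(M - j)`, or one of them is at least `2` and
its term suffices. -/
lemma two_site_excess_nonneg {M j α β a : ℤ} (hj : 0 < j) (hjM : j < M) (hα : 0 ≤ α) (hβ : 0 ≤ β)
    (ha : a = 0 ∨ a = 1) (h : 2 * a ≤ α + β) :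
    0 ≤ M * (j * α + (M - j) * β) - 2 * j * (M - j) * a := by
  have h1 : 0 < M - j := by linarith
  rcases ha with rfl | rfl
  · have : 0 ≤ M * (j * α + (M - j) * β) :=
      mul_nonneg (by linarith) (add_nonneg (mul_nonneg hj.le hα) (mul_nonneg h1.le hβ))
    linarith
  · have hM : 0 < M := by linarith
    rcases le_or_gt 1 α with h2 | h2
    · rcases le_or_gt 1 β with h3 | h3
      · have h4 : M ≤ j * α + (M - j) * β := by nlinarith
        nlinarith [sq_nonneg (M - 2 * j), mul_le_mul_of_nonneg_left h4 hM.le]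
      · have h3 : 2 ≤ α := by linarith
        have h4 : j * 2 ≤ j * α + (M - j) * β := by nlinarith
        nlinarith [mul_le_mul_of_nonneg_left h4 hM.le]
    · have h3 : 2 ≤ β := by linarith
      have h4 : (M - j) * 2 ≤ j * α + (M - j) * β := by nlinarith
      nlinarith [mul_le_mul_of_nonneg_left h4 hM.le, mul_pos h1 h1]

/-- Lowering one positive excess by `1` keeps the hypotheses of `two_site_excess_nonneg`, and that
unit contributes `Mj` or `M(M - j)`, at least `M ≥ 2`. -/
lemma two_site_excess_ge_two {M j α β a : ℤ} (hM : 2 ≤ M) (hj : 0 < j) (hjM : j < M) (hα : 0 ≤ α)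
    (hβ : 0 ≤ β) (ha : a = 0 ∨ a = 1) (h : 2 * a + 1 ≤ α + β) :
    2 ≤ M * (j * α + (M - j) * β) - 2 * j * (M - j) * a := by
  have h1 : 0 < M - j := by linarith
  have key : ∀ α' β' : ℤ, 0 ≤ α' → 0 ≤ β' → 2 * a ≤ α' + β' →
      (α = α' + 1 ∧ β = β') ∨ (α = α' ∧ β = β' + 1) →
      2 ≤ M * (j * α + (M - j) * β) - 2 * j * (M - j) * a := by
    intro α' β' h2 h3 h4 h5
    have h6 := two_site_excess_nonneg hj hjM h2 h3 ha h4
    rcases h5 with ⟨rfl, rfl⟩ | ⟨rfl, rfl⟩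
    · nlinarith
    · nlinarith
  rcases eq_or_lt_of_le hα with h2 | h2
  · exact key α (β - 1) hα (by rcases ha with rfl | rfl <;> linarith) (by linarith)
      (Or.inr ⟨rfl, by ring⟩)
  · exact key (α - 1) β (by linarith) hβ (by linarith) (Or.inl ⟨by ring, rfl⟩)

/-! ### Minimal energy and energy gap in the strip -/

section Strip

variable {L k : ℕ} {M : ℤ} {F : Finset (ℤ × Fin L)} {m : ℤ × Fin L → ℤ}

/-- The strip is bipartite; this is used to exclude triangles. -/
lemma strip_parity {x y : ℤ × Fin L} (h : (strip L).Adj x y) :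
    (x.1 + (x.2 : ℤ) + (y.1 + (y.2 : ℤ))) % 2 = 1 := by
  have h' : |x.1 - y.1| + |(x.2 : ℤ) - (y.2 : ℤ)| = 1 := h
  rcases abs_cases (x.1 - y.1) with h1 | h1 <;>
    rcases abs_cases ((x.2 : ℤ) - (y.2 : ℤ)) with h2 | h2 <;> omega

lemma adjInd_zero_or_one {V : Type*} (G : SimpleGraph V) (x y : V) :
    adjInd G x y = 0 ∨ adjInd G x y = 1 := by
  unfold adjInd
  split_ifs <;> simp

/-- Sum of the perimeters of two sets of `kL` sites that differ by exchanging `x` and `y`. -/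
lemma strip_perimeter_exchange (hL : 2 ≤ L) (hk : L ≤ 2 * k) {S : Finset (ℤ × Fin L)}
    (hS : S.card + 1 = k * L) {x y : ℤ × Fin L} (hx : x ∉ S) (hy : y ∉ S) (hxy : x ≠ y) :
    2 * adjInd (strip L) x y ≤ (perimeter (strip L) (insert x S) - 2 * L) +
        (perimeter (strip L) (insert y S) - 2 * L) ∧
      (¬ (L = 2 ∧ k = 1) → 2 * adjInd (strip L) x y + 1 ≤
        (perimeter (strip L) (insert x S) - 2 * L) +
        (perimeter (strip L) (insert y S) - 2 * L)) := by
  have h1 := perimeter_insert_insert (strip L) hx hy hxy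
  have hxy' : x ∉ insert y S := by simp [hx, hxy]
  have h2 : 2 * (L : ℤ) + 1 ≤ perimeter (strip L) (insert x (insert y S)) :=
    strip_perimeter_succ hL hk (by
      rw [Finset.card_insert_of_notMem hxy', Finset.card_insert_of_notMem hy, hS])
  have h3 := strip_perimeter_pred hL hk hS
  exact ⟨by linarith [h3.1], fun h => by linarith [h3.2 h]⟩

/-- The two occupations add up to `M`, so `S` has `kL - 1` sites and the energy is governed by the
perimeters of `S ∪ {x}` and `S ∪ {y}`, whose sum is controlled by `strip_perimeter_exchange`. -/
lemma energy_ge_of_two_frac (hL : 2 ≤ L) (hk : L ≤ 2 * k)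
    (hm : ∀ x ∈ F, 0 ≤ m x ∧ m x ≤ M) (hsum : ∑ x ∈ F, m x = k * L * M)
    (hcard : (fracSites M F m).card = 2) :
    2 * L * M ^ 2 ≤ energy (strip L) M F m ∧ (2 ≤ M → ¬ (L = 2 ∧ k = 1) →
      2 * L * M ^ 2 + 2 ≤ energy (strip L) M F m) := by
  obtain ⟨x, y, hxy, hfr⟩ := Finset.card_eq_two.1 hcard
  have hx : x ∈ fracSites M F m := by simp [hfr]
  have hy : y ∈ fracSites M F m := by simp [hfr]
  have hsd := sum_eq_full_add_frac hm
  rw [hsum, hfr, Finset.sum_pair hxy] at hsd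
  simp only [fracSites, Finset.mem_filter] at hx hy
  set S := fullSites M F m with hS
  have hSF : S ⊆ F := Finset.filter_subset _ _
  have hMpos : 0 < M := by omega
  have h1 : M * ((k * L : ℤ) - S.card) = m x + m y := by linarith
  have hc1 : (k * L : ℤ) - S.card = 1 := by
    have : 0 < (k * L : ℤ) - S.card := by
      by_contra hcon
      nlinarith
    have : (k * L : ℤ) - S.card < 2 := by
      by_contra hcon
      nlinarith
    omega
  have hScard : S.card + 1 = k * L := by
    have : (S.card : ℤ) + 1 = k * L := by linarith
    exact_mod_cast this
  have hyv : m x + m y = M := by rw [← h1, hc1]; ring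
  have hxS : x ∉ S := by simp [hS, fullSites]; omega
  have hyS : y ∉ S := by simp [hS, fullSites]; omega
  have hen : energy (strip L) M F m = m x * M * perimeter (strip L) (insert x S) +
      m y * M * perimeter (strip L) (insert y S) - 2 * m x * m y * adjInd (strip L) x y := by
    rw [← energy_indicator_add_single (strip L) M hSF hx.1 hy.1 hxS hyS _ _ hyv]
    refine energy_congr _ _ fun z hz => ?_
    simp only [Pi.add_apply, Pi.smul_apply, smul_eq_mul, Pi.single_apply]
    have hzz : z ∈ fracSites M F m ↔ z = x ∨ z = y := by simp [hfr]
    have hz' := hm z hz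
    simp only [fracSites, Finset.mem_filter, hz, true_and] at hzz
    have hzS : z ∈ S ↔ m z = M := by simp [hS, fullSites, hz]
    by_cases hzx : z = x
    · subst hzx; simp [hxS, hxy]
    by_cases hzy : z = y
    · subst hzy; simp [hyS, hzx]
    simp only [hzx, hzy, or_self, iff_false, if_false] at hzz ⊢
    by_cases hzm : z ∈ S
    · rw [if_pos hzm]; have := hzS.1 hzm; omega
    · rw [if_neg hzm]; have := mt hzS.2 hzm; omega
  have hex := strip_perimeter_exchange hL hk hScard hxS hyS hxy
  have hpx := strip_perimeter_mul hk (S := insert x S) (by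
    rw [Finset.card_insert_of_notMem hxS, hScard])
  have hpy := strip_perimeter_mul hk (S := insert y S) (by
    rw [Finset.card_insert_of_notMem hyS, hScard])
  obtain rfl : M = m x + m y := hyv.symm
  rw [hen]
  constructor
  · have := two_site_excess_nonneg hx.2.1 hx.2.2 (sub_nonneg.2 hpx) (sub_nonneg.2 hpy)
      (adjInd_zero_or_one (strip L) x y) hex.1
    linarith
  · intro hM hne
    have := two_site_excess_ge_two hM hx.2.1 hx.2.2 (sub_nonneg.2 hpx) (sub_nonneg.2 hpy)
      (adjInd_zero_or_one (strip L) x y) (hex.2 hne)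
    linarith

/-- Induction on the number of fractional sites: one is impossible by divisibility, two is the base
case, and three or more are reduced by a push. Keeping a fractional site throughout is what
preserves the strict bound. -/
lemma energy_ge_of_frac (hL : 2 ≤ L) (hk : L ≤ 2 * k)
    (hm : ∀ x ∈ F, 0 ≤ m x ∧ m x ≤ M) (hsum : ∑ x ∈ F, m x = k * L * M)
    (hne : (fracSites M F m).Nonempty) :
    2 * L * M ^ 2 ≤ energy (strip L) M F m ∧ (2 ≤ M → ¬ (L = 2 ∧ k = 1) →
      2 * L * M ^ 2 + 2 ≤ energy (strip L) M F m) := by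
  induction hn : (fracSites M F m).card using Nat.strong_induction_on generalizing m with
  | _ n ih =>
  have hpos : 0 < (fracSites M F m).card := Finset.card_pos.2 hne
  obtain h1 | h2 | h3 : (fracSites M F m).card = 1 ∨ (fracSites M F m).card = 2 ∨
    2 < (fracSites M F m).card := by omega
  · exfalso
    obtain ⟨x, hfr⟩ := Finset.card_eq_one.1 h1
    have hsd := sum_eq_full_add_frac hm
    rw [hsum, hfr, Finset.sum_singleton] at hsd
    have hx : x ∈ fracSites M F m := by simp [hfr]
    simp only [fracSites, Finset.mem_filter] at hx
    have hd : M ∣ m x := ⟨k * L - (fullSites M F m).card, by linarith⟩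
    exact absurd (Int.le_of_dvd hx.2.1 hd) (by omega)
  · exact energy_ge_of_two_frac hL hk hm hsum h2
  -- Three fractional sites cannot be pairwise adjacent in a bipartite graph.
  · obtain ⟨x, y, hx, hy, hxy, hadj⟩ : ∃ x y, x ∈ fracSites M F m ∧ y ∈ fracSites M F m ∧
        x ≠ y ∧ ¬ (strip L).Adj x y := by
      obtain ⟨a, b, c, ha, hb, hc, hab, hac, hbc⟩ := Finset.two_lt_card_iff.1 h3
      by_contra hcon
      push Not at hcon
      have e1 := strip_parity (hcon a b ha hb hab)
      have e2 := strip_parity (hcon a c ha hc hac)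
      have e3 := strip_parity (hcon b c hb hc hbc)
      omega
    obtain ⟨m', hm', hs', he', hc', hsub⟩ := exists_push (strip L) hm hx hy hxy hadj
    -- The push touches only `x` and `y`, so a third fractional site survives.
    have hne' : (fracSites M F m').Nonempty := by
      refine Finset.Nonempty.mono hsub (Finset.card_pos.1 ?_)
      have := Finset.le_card_sdiff {x, y} (fracSites M F m)
      have := Finset.card_le_two (a := x) (b := y)
      omega
    obtain ⟨r1, r2⟩ := ih _ (hn ▸ hc') hm' (hs'.trans hsum) hne' rfl
    exact ⟨r1.trans he', fun h h' => (r2 h h').trans he'⟩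

lemma energy_of_no_frac (hM : 0 < M)
    (hm : ∀ x ∈ F, 0 ≤ m x ∧ m x ≤ M) (hsum : ∑ x ∈ F, m x = k * L * M)
    (hne : fracSites M F m = ∅) :
    ∃ S : Finset (ℤ × Fin L), S.card = k * L ∧
      energy (strip L) M F m = M ^ 2 * perimeter (strip L) S := by
  refine ⟨fullSites M F m, ?_, ?_⟩
  · have hsd := sum_eq_full_add_frac hm
    rw [hsum, hne, Finset.sum_empty, add_zero, mul_comm] at hsd
    have := mul_left_cancel₀ hM.ne' hsd
    exact_mod_cast this.symm
  · have hsub : fullSites M F m ⊆ F := Finset.filter_subset _ F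
    rw [← energy_indicator (strip L) M hsub]
    refine energy_congr _ _ fun z hz => ?_
    have hzz : z ∉ fracSites M F m := by simp [hne]
    have := hm z hz
    simp only [fracSites, fullSites, Finset.mem_filter, hz, true_and] at hzz ⊢
    split_ifs <;> omega

/-- Droplets of `kLM` particles with `k ≥ L / 2` have energy at least `2LM²`. -/
theorem energy_ge (hL : 2 ≤ L) (hk : L ≤ 2 * k) (hM : 0 < M)
    (hm : ∀ x ∈ F, 0 ≤ m x ∧ m x ≤ M) (hsum : ∑ x ∈ F, m x = k * L * M) :
    2 * L * M ^ 2 ≤ energy (strip L) M F m := by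
  rcases (fracSites M F m).eq_empty_or_nonempty with h | h
  · obtain ⟨S, hS, he⟩ := energy_of_no_frac hM hm hsum h
    have := strip_perimeter_mul hk hS
    rw [he]
    nlinarith [sq_nonneg M]
  · exact (energy_ge_of_frac hL hk hm hsum h).1

lemma degZ_strip_two (x : ℤ × Fin 2) : degZ (strip 2) x = 3 := by
  obtain ⟨z, l⟩ := x
  have : (strip 2).neighborSet (z, l) =
      (({(z + 1, l), (z - 1, l), (z, 1 - l)} : Finset (ℤ × Fin 2)) : Set (ℤ × Fin 2)) := by
    ext ⟨z', l'⟩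
    simp only [SimpleGraph.mem_neighborSet, strip, Finset.coe_insert, Finset.coe_singleton,
      Set.mem_insert_iff, Set.mem_singleton_iff, Prod.mk.injEq]
    fin_cases l <;> fin_cases l' <;> simp <;>
      rcases abs_cases (z - z') with h1 | h1 <;> omega
  rw [degZ, this, Set.ncard_coe_finset]
  have h1 : (z - 1, l) ≠ (z, 1 - l) := by simp
  have h2 : (z + 1, l) ≠ (z, 1 - l) := by simp
  have h3 : (z + 1, l) ≠ (z - 1, l) := by
    intro h
    have := congrArg Prod.fst h
    simp only at this
    omega
  rw [Finset.card_insert_of_notMem (by simp [h2, h3]), Finset.card_insert_of_notMem (by simp [h1])]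
  simp

/-- The lowest two energies differ by at least `2`. -/
theorem energy_eq_or_ge (hL : 2 ≤ L) (hk : L ≤ 2 * k) (hM : 2 ≤ M)
    (hm : ∀ x ∈ F, 0 ≤ m x ∧ m x ≤ M) (hsum : ∑ x ∈ F, m x = k * L * M) :
    energy (strip L) M F m = 2 * L * M ^ 2 ∨ 2 * L * M ^ 2 + 2 ≤ energy (strip L) M F m := by
  have hge := energy_ge hL hk (by linarith) hm hsum
  by_cases hne : L = 2 ∧ k = 1
  · obtain ⟨rfl, rfl⟩ := hne
    -- For `L = 2`, `k = 1` fractional minimizers exist, so the strict bound fails. Instead, all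
    -- degrees are `3` and the particle number is `2M`, which makes the energy even.
    have heven : Even (energy (strip 2) M F m) := by
      rw [energy_eq]
      refine Even.sub ?_ (even_adjForm_self _ _ _)
      have : degSum (strip 2) F m = 2 * (3 * M) := by
        simp only [degSum, degZ_strip_two]
        rw [← Finset.mul_sum, hsum]
        push_cast
        ring
      rw [this]
      exact Even.mul_left (even_two_mul _) _
    obtain ⟨r, hr⟩ := heven
    push_cast at hge ⊢
    rw [hr] at hge ⊢
    generalize M ^ 2 = Q at *
    omega
  · rcases (fracSites M F m).eq_empty_or_nonempty with h | h
    · obtain ⟨S, hS, he⟩ := energy_of_no_frac (by linarith) hm hsum h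
      have h1 := strip_perimeter_mul hk hS
      rw [he]
      rcases eq_or_lt_of_le h1 with h2 | h2
      · left; rw [← h2]; ring
      · right
        nlinarith [sq_nonneg M]
    · exact Or.inr ((energy_ge_of_frac hL hk hm hsum h).2 hM hne)

end Strip

/-! ### The potential as a sum of hopping rates -/

section Darts

variable {V : Type*} {M N : ℕ} {G : SimpleGraph V}

lemma BoundedDegree.neighborSet_finite (hG : BoundedDegree G) (x : V) :
    (G.neighborSet x).Finite :=
  Set.finite_of_encard_le_coe (hG.choose_spec x)

/-- Ordered edges that start in `F`. -/
def dartsFrom (hG : BoundedDegree G) (F : Finset V) : Finset (V × V) :=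
  (F ×ˢ F.biUnion fun x => (hG.neighborSet_finite x).toFinset).filter fun p => G.Adj p.1 p.2

lemma mem_dartsFrom (hG : BoundedDegree G) {F : Finset V} {p : V × V} :
    p ∈ dartsFrom hG F ↔ p.1 ∈ F ∧ G.Adj p.1 p.2 := by
  simp only [dartsFrom, Finset.mem_filter, Finset.mem_product, Finset.mem_biUnion,
    Set.Finite.mem_toFinset, SimpleGraph.mem_neighborSet]
  exact ⟨fun h => ⟨h.1.1, h.2⟩, fun h => ⟨⟨h.1, p.1, h.1, h.2⟩, h.2⟩⟩

/-- The number of ways to move a particle from a filled place at `p.1` to a free one at `p.2`. -/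
def hopRate (m : Config V M N) (p : V × V) : ℝ := m.occ p.1 * (M - m.occ p.2)

lemma hopRate_nonneg (m : Config V M N) (p : V × V) : 0 ≤ hopRate m p :=
  mul_nonneg (Nat.cast_nonneg _) (sub_nonneg.2 (Nat.cast_le.2 (occ_le m p.2)))

lemma edgePotential_mk (m : Config V M N) (p : V × V) :
    edgePotential m (Sym2.mk p.1 p.2) = (hopRate m p + hopRate m p.swap) / 2 := by
  change (M : ℝ) / 2 * (m.occ p.1 + m.occ p.2) - m.occ p.1 * m.occ p.2 = _
  simp only [hopRate, Prod.swap]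
  ring

/-- An edge potential is the mean of the hopping rates in its two directions, and rates out of sites
outside `F` vanish. -/
lemma two_mul_potential (hG : BoundedDegree G) (m : Config V M N) {F : Finset V}
    (hF : m.1.support ⊆ F) : 2 * potential G m = ∑ p ∈ dartsFrom hG F, hopRate m p := by
  set D := dartsFrom hG F ∪ (dartsFrom hG F).image Prod.swap with hD
  have hmem : ∀ p : V × V, p ∈ D ↔ (p.1 ∈ F ∨ p.2 ∈ F) ∧ G.Adj p.1 p.2 := by
    rintro ⟨x, y⟩
    simp only [hD, Finset.mem_union, Finset.mem_image, mem_dartsFrom, Prod.exists, Prod.swap,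
      Prod.mk.injEq]
    constructor
    · rintro (h | ⟨a, b, h, rfl, rfl⟩)
      · exact ⟨Or.inl h.1, h.2⟩
      · exact ⟨Or.inr h.1, h.2.symm⟩
    · rintro ⟨h | h, h'⟩
      · exact Or.inl ⟨h, h'⟩
      · exact Or.inr ⟨y, x, ⟨h, h'.symm⟩, rfl, rfl⟩
  have hout : ∀ x, x ∉ F → m.occ x = 0 := fun x hx =>
    Finsupp.notMem_support_iff.1 fun h => hx (hF h)
  have h1 : potential G m = ∑ e ∈ D.image (fun p => Sym2.mk p.1 p.2), edgePotential m e := by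
    refine finsum_mem_eq_sum_of_inter_support_eq _ ?_
    ext e
    simp only [Set.mem_inter_iff, Function.mem_support, Finset.mem_coe]
    refine ⟨fun h => ⟨?_, h.2⟩, fun h => ⟨?_, h.2⟩⟩
    · induction e with
      | _ x y =>
        refine Finset.mem_image.2 ⟨(x, y), (hmem _).2 ⟨?_, h.1⟩, rfl⟩
        by_contra hcon
        push Not at hcon
        apply h.2
        change (M : ℝ) / 2 * (m.occ x + m.occ y) - m.occ x * m.occ y = 0
        simp [hout x hcon.1, hout y hcon.2]
    · obtain ⟨p, hp, rfl⟩ := Finset.mem_image.1 h.1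
      exact ((hmem p).1 hp).2
  have h2 : ∑ p ∈ D, edgePotential m (Sym2.mk p.1 p.2) = 2 * potential G m := by
    rw [h1, Finset.mul_sum,
      ← Finset.sum_fiberwise_of_maps_to (s := D) (fun p hp => Finset.mem_image_of_mem
        (fun p : V × V => Sym2.mk p.1 p.2) hp)]
    refine Finset.sum_congr rfl fun e he => ?_
    obtain ⟨p, hp, rfl⟩ := Finset.mem_image.1 he
    have hne : p ≠ p.swap := fun h => ((hmem p).1 hp).2.ne (congrArg Prod.fst h)
    have hfib : (D.filter fun q => Sym2.mk q.1 q.2 = Sym2.mk p.1 p.2) = {p, p.swap} := by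
      ext q
      simp only [Finset.mem_filter, Finset.mem_insert, Finset.mem_singleton, Sym2.eq_iff]
      constructor
      · rintro ⟨-, h | h⟩
        · exact Or.inl (Prod.ext h.1 h.2)
        · exact Or.inr (Prod.ext h.1 h.2)
      · rintro (rfl | rfl)
        · exact ⟨hp, Or.inl ⟨rfl, rfl⟩⟩
        · refine ⟨(hmem _).2 ?_, Or.inr ⟨rfl, rfl⟩⟩
          have := (hmem p).1 hp
          exact ⟨this.1.symm, this.2.symm⟩
    rw [hfib, Finset.sum_pair hne, two_mul]
    simp only [Prod.swap]
    rw [Sym2.eq_swap (a := p.2)]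
  have h3 : ∑ p ∈ D, hopRate m p.swap = ∑ p ∈ D, hopRate m p := by
    refine Finset.sum_bij (fun p _ => p.swap) (fun p hp => ?_) (fun p _ q _ h => Prod.swap_injective h)
      (fun p hp => ⟨p.swap, ?_, Prod.swap_swap p⟩) fun p _ => rfl
    · rw [hmem] at hp ⊢
      exact ⟨hp.1.symm, hp.2.symm⟩
    · rw [hmem] at hp ⊢
      exact ⟨hp.1.symm, hp.2.symm⟩
  rw [← h2, Finset.sum_congr rfl fun p _ => edgePotential_mk m p, ← Finset.sum_div,
    Finset.sum_add_distrib, h3, add_self_div_two]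
  refine (Finset.sum_subset Finset.subset_union_left fun p hp hp' => ?_).symm
  rw [mem_dartsFrom] at hp'
  have : p.1 ∉ F := fun h => hp' ⟨h, ((hmem p).1 hp).2⟩
  simp [hopRate, hout p.1 this]

lemma sum_hopRate (hG : BoundedDegree G) (m : Config V M N) {F : Finset V}
    (hF : m.1.support ⊆ F) :
    ∑ p ∈ dartsFrom hG F, hopRate m p = (energy G M F (fun x => (m.occ x : ℤ)) : ℝ) := by
  set U := F.biUnion fun x => (hG.neighborSet_finite x).toFinset with hU
  have hout : ∀ x, x ∉ F → m.occ x = 0 := fun x hx =>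
    Finsupp.notMem_support_iff.1 fun h => hx (hF h)
  have hUmem : ∀ x ∈ F, ∀ y, G.Adj x y → y ∈ U := fun x hx y h =>
    Finset.mem_biUnion.2 ⟨x, hx, by simpa using h⟩
  have hint : ∑ p ∈ dartsFrom hG F, (m.occ p.1 : ℤ) * (M - m.occ p.2) =
      energy G M F (fun x => (m.occ x : ℤ)) := by
    rw [dartsFrom, Finset.sum_filter, Finset.sum_product, energy, adjForm, Finset.mul_sum,
      ← Finset.sum_sub_distrib]
    refine Finset.sum_congr rfl fun x hx => ?_
    have h1 : degZ G x = ∑ y ∈ U, adjInd G x y := by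
      simp only [adjInd]
      rw [Finset.sum_boole, degZ, ← Set.ncard_coe_finset]
      congr 2
      ext y
      simp only [SimpleGraph.mem_neighborSet, Finset.coe_filter, Set.mem_ofPred_eq]
      exact ⟨fun h => ⟨hUmem x hx y h, h⟩, fun h => h.2⟩
    have h2 : ∑ y ∈ F, adjInd G x y * ((m.occ x : ℤ) * m.occ y) =
        ∑ y ∈ U, adjInd G x y * ((m.occ x : ℤ) * m.occ y) := by
      rw [Finset.sum_subset (Finset.subset_union_left (s₁ := F) (s₂ := U)),
        Finset.sum_subset (Finset.subset_union_right (s₁ := F) (s₂ := U))]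
      · intro y _ hy
        rw [adjInd, if_neg fun h => hy (hUmem x hx y h), zero_mul]
      · intro y _ hy
        simp [hout y hy]
    rw [h1, h2, Finset.sum_mul, Finset.mul_sum, ← Finset.sum_sub_distrib]
    refine Finset.sum_congr rfl fun y _ => ?_
    unfold adjInd
    split_ifs <;> ring
  rw [← hint]
  push_cast
  rfl

lemma two_mul_potential_eq_energy (hG : BoundedDegree G) (m : Config V M N) {F : Finset V}
    (hF : m.1.support ⊆ F) :
    2 * potential G m = (energy G M F (fun x => (m.occ x : ℤ)) : ℝ) := by
  rw [two_mul_potential hG m hF, sum_hopRate hG m hF]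

lemma potential_nonneg (hG : BoundedDegree G) (m : Config V M N) : 0 ≤ potential G m := by
  have := two_mul_potential hG m subset_rfl
  have h : 0 ≤ ∑ p ∈ dartsFrom hG m.1.support, hopRate m p :=
    Finset.sum_nonneg fun p _ => hopRate_nonneg m p
  linarith

lemma sum_occ (m : Config V M N) {F : Finset V} (hF : m.1.support ⊆ F) :
    ∑ x ∈ F, (m.occ x : ℤ) = N := by
  rw [← Finset.sum_subset hF (f := fun x => (m.occ x : ℤ)) fun x _ hx => by
    have : m.1 x = 0 := by simpa using hx
    simp [Config.occ, this]]
  exact_mod_cast m.2.2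

/-- A configuration from a function with given bounds and finite support. -/
def mkConfig (f : V → ℕ) (F : Finset V) (h0 : ∀ x, f x ≠ 0 → x ∈ F) (hM : ∀ x, f x ≤ M)
    (hN : ∑ x ∈ F, f x = N) : Config V M N :=
  ⟨Finsupp.onFinset F f h0, hM, by
    rw [Finsupp.onFinset_sum _ fun _ => rfl]
    exact hN⟩

/-- The parallelogram law: with the capacity doubled the linear parts agree, and the difference of
the two sides is the adjacency form of `m - n = e_x - e_y`, which is `-2`. -/
lemma energy_double {m n : Config V M N} {F : Finset V} {x y : V} (hx : x ∈ F) (hy : y ∈ F)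
    (hxy : G.Adj x y) (h1 : m.occ x = n.occ x + 1) (h2 : n.occ y = m.occ y + 1)
    (h3 : ∀ z, z ≠ x → z ≠ y → m.occ z = n.occ z) :
    energy G (2 * M) F (fun z => (m.occ z : ℤ) + n.occ z) =
      2 * energy G M F (fun z => (m.occ z : ℤ)) + 2 * energy G M F (fun z => (n.occ z : ℤ)) - 2 := by
  have hm : (fun z => (m.occ z : ℤ)) = (fun z => (n.occ z : ℤ)) + hop x y := by
    funext z
    by_cases hzx : z = x
    · subst hzx; simp [hop_apply_left hxy.ne, h1]
    by_cases hzy : z = y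
    · subst hzy; simp [hop_apply_right hxy.ne, h2]
    simp [hop_apply_of_ne hzx hzy, h3 z hzx hzy]
  have hadd : (fun z => (m.occ z : ℤ) + n.occ z) =
      (fun z => (m.occ z : ℤ)) + (fun z => (n.occ z : ℤ)) := rfl
  have hd : adjForm G F (hop x y) (hop x y) = -2 := by
    rw [adjForm_hop G hx hy, adjInd, if_pos hxy]
    rfl
  rw [hadd, hm]
  generalize (fun z => (n.occ z : ℤ)) = ν
  simp only [energy_eq, degSum_add, adjForm_add_left, adjForm_add_right, hd]
  rw [adjForm_comm G F ν (hop x y)]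
  ring

end Darts

/-! ### Minimizers of the potential in the strip -/

section Strip

variable {L M k : ℕ}

lemma strip_potential_eq_or_ge (hL : 2 ≤ L) (hk : L ≤ 2 * k) (hM : 2 ≤ M)
    (m : Config (ℤ × Fin L) M (k * L * M)) :
    potential (strip L) m = L * M ^ 2 ∨ L * (M : ℝ) ^ 2 + 1 ≤ potential (strip L) m := by
  have h := two_mul_potential_eq_energy (strip_boundedDegree L) m subset_rfl
  have hs := sum_occ m subset_rfl
  push_cast at hs
  rcases energy_eq_or_ge hL hk (by exact_mod_cast hM) (fun x _ =>
    ⟨Nat.cast_nonneg _, Nat.cast_le.2 (occ_le m x)⟩) hs with h1 | h1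
  · left
    rw [h1] at h
    push_cast at h
    linarith
  · right
    have h2 : (2 * L * (M : ℝ) ^ 2 + 2) ≤
        (energy (strip L) M m.1.support (fun x => (m.occ x : ℤ)) : ℝ) := by exact_mod_cast h1
    linarith

lemma strip_potential_ge (hL : 2 ≤ L) (hk : L ≤ 2 * k) (hM : 2 ≤ M)
    (m : Config (ℤ × Fin L) M (k * L * M)) : L * (M : ℝ) ^ 2 ≤ potential (strip L) m := by
  rcases strip_potential_eq_or_ge hL hk hM m with h | h <;> linarith

/-- Two potential minimizers are never adjacent. -/
lemma strip_minimizers_not_adj (hL : 2 ≤ L) (hk : L ≤ 2 * k) (hM : 2 ≤ M)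
    {m n : Config (ℤ × Fin L) M (k * L * M)}
    (hadj : (particleGraph (strip L) M (k * L * M)).Adj m n)
    (hm : potential (strip L) m = L * M ^ 2) : potential (strip L) n ≠ L * M ^ 2 := by
  intro hn
  obtain ⟨x, y, hxy, h1, h2, h3⟩ := hadj
  set F := m.1.support ∪ n.1.support with hF
  have hmF : m.1.support ⊆ F := Finset.subset_union_left
  have hnF : n.1.support ⊆ F := Finset.subset_union_right
  have hx : x ∈ F := hmF (Finsupp.mem_support_iff.2 (by change m.occ x ≠ 0; omega))
  have hy : y ∈ F := hnF (Finsupp.mem_support_iff.2 (by change n.occ y ≠ 0; omega))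
  have e1 := two_mul_potential_eq_energy (strip_boundedDegree L) m hmF
  have e2 := two_mul_potential_eq_energy (strip_boundedDegree L) n hnF
  rw [hm] at e1
  rw [hn] at e2
  have e1' : 2 * ((L : ℤ) * M ^ 2) = energy (strip L) M F (fun x => (m.occ x : ℤ)) := by
    exact_mod_cast e1
  have e2' : 2 * ((L : ℤ) * M ^ 2) = energy (strip L) M F (fun x => (n.occ x : ℤ)) := by
    exact_mod_cast e2
  have e3 := energy_double hx hy hxy h1 h2 h3
  -- The sum `m + n` is an admissible competitor for capacity `2M` and `2kLM` particles, hence has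
  -- energy at least `8LM²`; `e3` gives `8LM² - 2`.
  have e4 := energy_ge (k := k) (M := 2 * (M : ℤ)) (F := F)
    (m := fun z => (m.occ z : ℤ) + n.occ z) hL hk (by omega) (fun z _ => by
      have := occ_le m z
      have := occ_le n z
      constructor <;> omega) (by
      rw [Finset.sum_add_distrib, sum_occ m hmF, sum_occ n hnF]
      push_cast
      ring)
  rw [e3, ← e1', ← e2'] at e4
  nlinarith

/-- The sites of `k` consecutive columns. -/
def columns (L k : ℕ) : Finset (ℤ × Fin L) := Finset.Ioc 0 (k : ℤ) ×ˢ Finset.univ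

lemma card_columns (L k : ℕ) : (columns L k).card = k * L := by
  simp [columns]

/-- Only the right edges of the last column and the left edges of the first leave the block. -/
lemma perimeter_columns_le (L k : ℕ) : perimeter (strip L) (columns L k) ≤ 2 * L := by
  obtain ⟨D, hmem, hD⟩ := exists_perimeter_eq_card _ (strip_neighborSet_finite L) (columns L k)
  rw [hD]
  have hsub : D ⊆ (Finset.univ : Finset (Fin L)).image
        (fun l => (((k : ℤ), l), ((k : ℤ) + 1, l))) ∪
      (Finset.univ : Finset (Fin L)).image (fun l => (((1 : ℤ), l), ((0 : ℤ), l))) := by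
    rintro ⟨⟨z, l⟩, ⟨z', l'⟩⟩ hp
    obtain ⟨h1, h2, h3⟩ := (hmem _ _).1 hp
    simp only [columns, Finset.mem_product, Finset.mem_Ioc, Finset.mem_univ, and_true] at h1 h2
    have h3' : |z - z'| + |(l : ℤ) - (l' : ℤ)| = 1 := h3
    simp only [Finset.mem_union, Finset.mem_image, Finset.mem_univ, true_and, Prod.mk.injEq]
    have hl : l = l' := by
      apply Fin.ext
      rcases abs_cases (z - z') with a | a <;>
        rcases abs_cases ((l : ℤ) - (l' : ℤ)) with b | b <;> omega
    subst hl
    rw [sub_self, abs_zero, add_zero] at h3'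
    rcases abs_cases (z - z') with a | a
    · exact Or.inr ⟨l, by omega⟩
    · exact Or.inl ⟨l, by omega⟩
  have h1 := Finset.card_le_card hsub
  have h2 := Finset.card_union_le ((Finset.univ : Finset (Fin L)).image
        (fun l => (((k : ℤ), l), ((k : ℤ) + 1, l))))
      ((Finset.univ : Finset (Fin L)).image (fun l => (((1 : ℤ), l), ((0 : ℤ), l))))
  have h3 := Finset.card_image_le (s := (Finset.univ : Finset (Fin L)))
    (f := fun l => (((k : ℤ), l), ((k : ℤ) + 1, l)))
  have h4 := Finset.card_image_le (s := (Finset.univ : Finset (Fin L)))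
    (f := fun l => (((1 : ℤ), l), ((0 : ℤ), l)))
  rw [Finset.card_univ, Fintype.card_fin] at h3 h4
  have : D.card ≤ 2 * L := by omega
  exact_mod_cast this

/-- The droplet filling `k` columns. -/
def droplet (L M k : ℕ) : Config (ℤ × Fin L) M (k * L * M) :=
  mkConfig (fun x => if x ∈ columns L k then M else 0) (columns L k)
    (fun x h => by by_contra hx; simp [hx] at h) (fun x => by split_ifs <;> simp)
    (by rw [Finset.sum_ite_mem, Finset.inter_self, Finset.sum_const, card_columns, smul_eq_mul])

lemma droplet_occ (L M k : ℕ) (x : ℤ × Fin L) :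
    (droplet L M k).occ x = if x ∈ columns L k then M else 0 := rfl

lemma potential_droplet (hL : 2 ≤ L) (hk : L ≤ 2 * k) (hM : 2 ≤ M) :
    potential (strip L) (droplet L M k) = L * M ^ 2 := by
  have h := two_mul_potential_eq_energy (strip_boundedDegree L) (droplet L M k)
    (F := columns L k) fun x hx => by
      by_contra hcon
      exact Finsupp.mem_support_iff.1 hx (by
        change (droplet L M k).occ x = 0
        rw [droplet_occ, if_neg hcon])
  have he := energy_indicator (strip L) (M : ℤ) (subset_refl (columns L k))
  have hf : (fun x => ((droplet L M k).occ x : ℤ)) =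
      fun x => if x ∈ columns L k then (M : ℤ) else 0 := by
    funext x
    rw [droplet_occ]
    split_ifs <;> rfl
  rw [hf, he] at h
  have h1 := strip_potential_ge hL hk hM (droplet L M k)
  have h2 : (perimeter (strip L) (columns L k) : ℝ) ≤ 2 * L := by
    exact_mod_cast perimeter_columns_le L k
  push_cast at h
  nlinarith [sq_nonneg (M : ℝ)]

/-- A droplet has a neighbour: a particle can leave it. -/
lemma exists_adj_droplet (hL : 2 ≤ L) (hk : L ≤ 2 * k) (hM : 2 ≤ M) :
    ∃ n, (particleGraph (strip L) M (k * L * M)).Adj (droplet L M k) n := by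
  let x : ℤ × Fin L := (k, ⟨0, by omega⟩)
  let y : ℤ × Fin L := (k + 1, ⟨0, by omega⟩)
  have hxy : x ≠ y := fun h => by
    have := congrArg Prod.fst h
    simp only [x, y] at this
    omega
  have hxS : x ∈ columns L k := by
    simp only [columns, x, Finset.mem_product, Finset.mem_Ioc, Finset.mem_univ, and_true]
    omega
  have hyS : y ∉ columns L k := by
    simp only [columns, y, Finset.mem_product, Finset.mem_Ioc, Finset.mem_univ, and_true]
    omega
  let f : ℤ × Fin L → ℕ := fun z =>
    if z = x then M - 1 else if z = y then 1 else if z ∈ columns L k then M else 0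
  have hsum : ∑ z ∈ insert y (columns L k), f z = k * L * M := by
    rw [Finset.sum_insert hyS, ← Finset.add_sum_erase _ _ hxS]
    have h1 : ∑ z ∈ (columns L k).erase x, f z = ((columns L k).erase x).card * M := by
      rw [← smul_eq_mul, ← Finset.sum_const]
      refine Finset.sum_congr rfl fun z hz => ?_
      rw [Finset.mem_erase] at hz
      have hzy : z ≠ y := fun h => hyS (h ▸ hz.2)
      simp [f, hz.1, hzy, hz.2]
    have h2 : ((columns L k).erase x).card + 1 = k * L := by
      rw [Finset.card_erase_add_one hxS, card_columns]
    have h3 : f x = M - 1 := by simp [f]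
    have h4 : f y = 1 := by simp [f, hxy.symm]
    rw [h1, h3, h4, ← h2, add_mul]
    omega
  refine ⟨mkConfig f (insert y (columns L k)) ?_ ?_ hsum, x, y, strip_adj_right _ _, ?_, ?_, ?_⟩
  · intro z hz
    by_contra hcon
    rw [Finset.mem_insert, not_or] at hcon
    have hzx : z ≠ x := fun h => hcon.2 (h ▸ hxS)
    simp [f, hzx, hcon.1, hcon.2] at hz
  · intro z
    simp only [f]
    split_ifs <;> omega
  · change (droplet L M k).occ x = f x + 1
    simp only [droplet_occ, hxS, f, if_true]
    omega
  · change f y = (droplet L M k).occ y + 1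
    simp [droplet_occ, hyS, f, hxy.symm]
  · intro z h1 h2
    change (droplet L M k).occ z = f z
    simp [droplet_occ, f, h1, h2]

end Strip

/-! ### Spectral gaps of self-adjoint operators from quadratic forms -/

section Abstract

variable {H : Type*} [NormedAddCommGroup H] [InnerProductSpace ℂ H]

lemma mem_realSpectrum_iff (T : H →L[ℂ] H) (E : ℝ) : E ∈ spectrum ℝ T ↔ E ∈ realSpectrum T :=
  (spectrum.algebraMap_mem_iff ℂ).symm

lemma realSpectrum_eq (T : H →L[ℂ] H) : realSpectrum T = spectrum ℝ T := by
  ext E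
  exact (mem_realSpectrum_iff T E).symm

lemma re_inner_real_smul_self (c : ℝ) (f : H) : (inner ℂ ((c : ℂ) • f) f).re = c * ‖f‖ ^ 2 := by
  rw [inner_smul_left, Complex.conj_ofReal, Complex.re_ofReal_mul]
  congr 1
  exact (norm_sq_eq_re_inner (𝕜 := ℂ) f).symm

lemma algebraMap_real_apply (c : ℝ) (f : H) : algebraMap ℝ (H →L[ℂ] H) c f = (c : ℂ) • f := by
  rw [Algebra.algebraMap_eq_smul_one]
  simp

variable [CompleteSpace H] {T : H →L[ℂ] H}

lemma algebraMap_le_iff_form (hT : IsSelfAdjoint T) (c : ℝ) :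
    algebraMap ℝ (H →L[ℂ] H) c ≤ T ↔ ∀ f, c * ‖f‖ ^ 2 ≤ (inner ℂ (T f) f).re := by
  rw [ContinuousLinearMap.le_def, ContinuousLinearMap.isPositive_def']
  have hsa : IsSelfAdjoint (T - algebraMap ℝ (H →L[ℂ] H) c) :=
    hT.sub (IsSelfAdjoint.algebraMap _ (IsSelfAdjoint.all c))
  have key : ∀ f, (inner ℂ ((T - algebraMap ℝ (H →L[ℂ] H) c) f) f).re =
      (inner ℂ (T f) f).re - c * ‖f‖ ^ 2 := fun f => by
    rw [sub_apply, inner_sub_left, Complex.sub_re,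
      algebraMap_real_apply, re_inner_real_smul_self]
  exact ⟨fun h f => by have := h.2 f; rw [← sub_nonneg, ← key]; exact this,
    fun h => ⟨hsa, fun f => by have := h f; rw [← sub_nonneg, ← key] at this; exact this⟩⟩

/-- The spectrum of a self-adjoint operator reaches below each of its expectation values. -/
lemma exists_spectrum_le (hT : IsSelfAdjoint T) {f : H} (hf : f ≠ 0) {c : ℝ}
    (h : (inner ℂ (T f) f).re ≤ c * ‖f‖ ^ 2) : (realSpectrum T ∩ Set.Iic c).Nonempty := by
  rw [realSpectrum_eq]
  by_contra hcon
  rw [Set.not_nonempty_iff_eq_empty, Set.eq_empty_iff_forall_notMem] at hcon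
  have hgt : ∀ E ∈ spectrum ℝ T, c < E := fun E hE => by
    by_contra hle
    exact hcon E ⟨hE, not_lt.1 hle⟩
  -- Compactness of the spectrum gives a uniform margin above `c`, which the expectation value at
  -- `f` then contradicts.
  obtain ⟨b, hcb, hb⟩ : ∃ b, c < b ∧ ∀ E ∈ spectrum ℝ T, b ≤ E := by
    rcases (spectrum ℝ T).eq_empty_or_nonempty with h0 | h0
    · exact ⟨c + 1, by linarith, by simp [h0]⟩
    · obtain ⟨b, hb, hmin⟩ := (ContinuousFunctionalCalculus.isCompact_spectrum T).exists_isLeast h0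
      exact ⟨b, hgt b hb, fun E hE => hmin hE⟩
  have := (algebraMap_le_iff_form hT b).1 ((algebraMap_le_iff_le_spectrum (a := T)).2 hb) f
  have hn : 0 < ‖f‖ ^ 2 := by positivity
  nlinarith

lemma exists_le_spectrum (hT : IsSelfAdjoint T) {f : H} (hf : f ≠ 0) {c : ℝ}
    (h : c * ‖f‖ ^ 2 ≤ (inner ℂ (T f) f).re) : (realSpectrum T ∩ Set.Ici c).Nonempty := by
  obtain ⟨E, hE, hEc⟩ := exists_spectrum_le hT.neg hf (c := -c) (by
    rw [neg_apply, inner_neg_left, Complex.neg_re]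
    linarith)
  refine ⟨-E, ?_, by simp only [Set.mem_Iic] at hEc; simp only [Set.mem_Ici]; linarith⟩
  rw [realSpectrum_eq] at hE ⊢
  rw [← spectrum.neg_eq] at hE
  simpa using hE

lemma spectrum_ge_of_form (hT : IsSelfAdjoint T) {c : ℝ}
    (h : ∀ f, c * ‖f‖ ^ 2 ≤ (inner ℂ (T f) f).re) {E : ℝ} (hE : E ∈ realSpectrum T) : c ≤ E := by
  rw [realSpectrum_eq] at hE
  exact (algebraMap_le_iff_le_spectrum (a := T)).1 ((algebraMap_le_iff_form hT c).2 h) E hE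

/-- A self-adjoint operator whose form is at most `lo` on the range of a projection and at least
`hi` on its complement has an inverse away from `(lo, hi)`, controlled by the distance to the
endpoints; off-diagonal terms play no role. -/
lemma norm_resolvent_ge (hT : IsSelfAdjoint T) {P : H →L[ℂ] H} (hP : IsSelfAdjoint P)
    (hPP : ∀ f, P (P f) = P f) {lo hi E c : ℝ}
    (hlo : ∀ f, (inner ℂ (T (P f)) (P f)).re ≤ lo * ‖P f‖ ^ 2)
    (hhi : ∀ f, hi * ‖f - P f‖ ^ 2 ≤ (inner ℂ (T (f - P f)) (f - P f)).re)
    (hc1 : c ≤ E - lo) (hc2 : c ≤ hi - E) (f : H) :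
    c * ‖f‖ ^ 2 ≤ (inner ℂ (T f - (E : ℂ) • f) ((f - P f) - P f)).re := by
  have hsym := ContinuousLinearMap.isSelfAdjoint_iff_isSymmetric.1 hT
  have hPsym := ContinuousLinearMap.isSelfAdjoint_iff_isSymmetric.1 hP
  have horth : inner ℂ (P f) (f - P f) = 0 := by
    rw [inner_sub_right, sub_eq_zero]
    have := hPsym (P f) f
    simp only [ContinuousLinearMap.coe_coe, hPP] at this
    exact this
  have horth' : inner ℂ (f - P f) (P f) = 0 := inner_eq_zero_symm.1 horth
  have hl := hlo f
  have hh := hhi f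
  set h := P f with hh'
  set g := f - P f with hg
  have hf : f = g + h := by rw [hg, hh']; abel
  -- In `⟨T(g + h), g - h⟩` the cross terms occur with opposite signs, so their real parts cancel.
  have hcross : (inner ℂ (T h) g).re = (inner ℂ (T g) h).re := by
    have h1 := hsym h g
    simp only [ContinuousLinearMap.coe_coe] at h1
    rw [h1, ← inner_conj_symm, Complex.conj_re]
  have hnorm : ‖f‖ ^ 2 = ‖g‖ ^ 2 + ‖h‖ ^ 2 := by
    have := norm_add_sq_eq_norm_sq_add_norm_sq_of_inner_eq_zero g h horth'
    rw [← hf] at this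
    nlinarith
  have e1 : (inner ℂ (T f - (E : ℂ) • f) (g - h)).re =
      (inner ℂ (T g) g).re - (inner ℂ (T h) h).re - E * ‖g‖ ^ 2 + E * ‖h‖ ^ 2 := by
    rw [← re_inner_real_smul_self, ← re_inner_real_smul_self, hf, map_add, smul_add]
    simp only [inner_sub_left, inner_sub_right, inner_add_left, inner_smul_left, horth, horth',
      Complex.sub_re, Complex.add_re, hcross, mul_zero]
    simp
    ring
  rw [e1, hnorm]
  nlinarith [sq_nonneg ‖g‖, sq_nonneg ‖h‖]

/-- Under the hypotheses of `norm_resolvent_ge`, the resolvent exists and is bounded by `c⁻¹`. -/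
lemma exists_resolvent (hT : IsSelfAdjoint T) {P : H →L[ℂ] H} (hP : IsSelfAdjoint P)
    (hPP : ∀ f, P (P f) = P f) {lo hi E c : ℝ}
    (hlo : ∀ f, (inner ℂ (T (P f)) (P f)).re ≤ lo * ‖P f‖ ^ 2)
    (hhi : ∀ f, hi * ‖f - P f‖ ^ 2 ≤ (inner ℂ (T (f - P f)) (f - P f)).re)
    (hc : 0 < c) (hc1 : c ≤ E - lo) (hc2 : c ≤ hi - E) :
    ∃ R : H →L[ℂ] H, (∀ f, T (R f) - (E : ℂ) • R f = f) ∧ (∀ f, R (T f - (E : ℂ) • f) = f) ∧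
      ∀ f, ‖R f‖ ≤ c⁻¹ * ‖f‖ := by
  have hge := norm_resolvent_ge hT hP hPP hlo hhi hc1 hc2
  have hPsym := ContinuousLinearMap.isSelfAdjoint_iff_isSymmetric.1 hP
  set A : H →L[ℂ] H := T - (E : ℂ) • 1 with hA
  set J : H →L[ℂ] H := 1 - P - P with hJ
  have hAf : ∀ f, A f = T f - (E : ℂ) • f := fun f => by simp [hA]
  have hJf : ∀ f, J f = (f - P f) - P f := fun f => by simp [hJ]
  have hJJ : J * J = 1 := by
    ext f
    simp only [mul_apply_eq_comp, hJf, map_sub, hPP, one_apply_eq_self]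
    abel
  have hJu : IsUnit J := ⟨⟨J, J, hJJ, hJJ⟩, rfl⟩
  have hJsym : ∀ f g, inner ℂ (J f) g = inner ℂ f (J g) := fun f g => by
    have := hPsym f g
    simp only [ContinuousLinearMap.coe_coe] at this
    simp only [hJf, inner_sub_left, inner_sub_right, this]
  have hJnorm : ∀ f, ‖J f‖ = ‖f‖ := fun f => by
    have h1 : ‖J f‖ ^ 2 = ‖f‖ ^ 2 := by
      rw [norm_sq_eq_re_inner (𝕜 := ℂ), norm_sq_eq_re_inner (𝕜 := ℂ), hJsym]
      have : J (J f) = f := congrArg (fun S : H →L[ℂ] H => S f) hJJ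
      rw [this]
    exact (sq_eq_sq₀ (norm_nonneg _) (norm_nonneg _)).1 h1
  -- `J = 1 - 2P` is a unitary involution, and `J * A` is coercive, hence invertible; then so is `A
  -- = J * (J * A)`.
  have hJA : IsUnit (J * A) := by
    refine ContinuousLinearMap.isUnit_of_forall_le_norm_inner_map (J * A) (c := ⟨c, hc.le⟩) hc
      fun f => ?_
    have h1 : inner ℂ ((J * A) f) f = inner ℂ (T f - (E : ℂ) • f) ((f - P f) - P f) := by
      rw [mul_apply_eq_comp, hJsym, hAf, hJf]
    rw [h1, mul_comm]
    exact (hge f).trans (Complex.re_le_norm _)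
  have hAu : IsUnit A := by
    have : A = J * (J * A) := by rw [← mul_assoc, hJJ, one_mul]
    rw [this]
    exact hJu.mul hJA
  obtain ⟨u, hu⟩ := hAu
  have hr : ∀ f, A ((↑u⁻¹ : H →L[ℂ] H) f) = f := fun f => by
    rw [← hu, ← mul_apply_eq_comp, Units.mul_inv, one_apply_eq_self]
  have hl : ∀ f, (↑u⁻¹ : H →L[ℂ] H) (A f) = f := fun f => by
    rw [← hu, ← mul_apply_eq_comp, Units.inv_mul, one_apply_eq_self]
  have hbound : ∀ f, c * ‖f‖ ≤ ‖A f‖ := fun f => by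
    rcases eq_or_ne f 0 with rfl | hf
    · simp
    have h1 : c * ‖f‖ ^ 2 ≤ ‖A f‖ * ‖f‖ := by
      refine ((hge f).trans (Complex.re_le_norm _)).trans ((norm_inner_le_norm _ _).trans ?_)
      rw [← hAf, ← hJf, hJnorm]
    have hn : 0 < ‖f‖ := norm_pos_iff.2 hf
    nlinarith
  refine ⟨↑u⁻¹, fun f => by rw [← hAf]; exact hr f, fun f => by rw [← hAf]; exact hl f, fun f => ?_⟩
  have := hbound ((↑u⁻¹ : H →L[ℂ] H) f)
  rw [hr] at this
  rw [inv_mul_eq_div, le_div_iff₀ hc, mul_comm]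
  exact this

end Abstract

/-! ### Resolvents and direct sums -/

section Resolvent

variable {H : Type*} [NormedAddCommGroup H] [NormedSpace ℂ H]

/-- Puts the bounded case in the form of `pmapResolventSet`, with `T - E` in place of `E - T`; hence
the sign of the inverse. -/
lemma notMem_realSpectrum_iff (T : H →L[ℂ] H) (E : ℝ) :
    E ∉ realSpectrum T ↔ ∃ R : H →L[ℂ] H,
      (∀ f, T (R f) - (E : ℂ) • R f = f) ∧ ∀ f, R (T f - (E : ℂ) • f) = f := by
  have h0 : E ∉ realSpectrum T ↔ IsUnit (algebraMap ℂ (H →L[ℂ] H) E - T) := by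
    simp [realSpectrum, spectrum.mem_iff]
  have hB : ∀ f, (algebraMap ℂ (H →L[ℂ] H) E - T) f = -(T f - (E : ℂ) • f) := fun f => by
    simp [Algebra.algebraMap_eq_smul_one]
  rw [h0]
  constructor
  · rintro ⟨u, hu⟩
    refine ⟨-↑u⁻¹, fun f => ?_, fun f => ?_⟩
    · have : (algebraMap ℂ (H →L[ℂ] H) E - T) ((↑u⁻¹ : H →L[ℂ] H) f) = f := by
        rw [← hu, ← mul_apply_eq_comp, Units.mul_inv, one_apply_eq_self]
      rw [hB] at this
      rw [neg_apply, map_neg, smul_neg, neg_sub_neg]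
      rwa [neg_sub] at this
    · have : (↑u⁻¹ : H →L[ℂ] H) ((algebraMap ℂ (H →L[ℂ] H) E - T) f) = f := by
        rw [← hu, ← mul_apply_eq_comp, Units.inv_mul, one_apply_eq_self]
      rw [hB, map_neg] at this
      rw [neg_apply]
      exact this
  · rintro ⟨R, h1, h2⟩
    refine ⟨⟨_, -R, ?_, ?_⟩, rfl⟩
    · ext f
      rw [mul_apply_eq_comp, hB, neg_apply, map_neg, smul_neg, ← h1 f]
      simp only [h1]
      rw [one_apply_eq_self, ← neg_sub', neg_neg, h1]
    · ext f
      rw [mul_apply_eq_comp, hB, neg_apply, map_neg, neg_neg, h2, one_apply_eq_self]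

end Resolvent

section DirectSum

variable {ι : Type*} {E : ι → Type*} [∀ i, NormedAddCommGroup (E i)] [∀ i, NormedSpace ℂ (E i)]

lemma memℓp_map {S : ∀ i, E i →L[ℂ] E i} {K : ℝ} (hK : 0 ≤ K) (hS : ∀ i f, ‖S i f‖ ≤ K * ‖f‖)
    (f : lp E 2) : Memℓp (fun i => S i (f i)) 2 ∧
      ∀ h : Memℓp (fun i => S i (f i)) 2, ‖(⟨_, h⟩ : lp E 2)‖ ≤ K * ‖f‖ := by
  have hsum : ∀ s : Finset ι, ∑ i ∈ s, ‖S i (f i)‖ ^ (2 : ENNReal).toReal ≤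
      (K * ‖f‖) ^ (2 : ENNReal).toReal := by
    intro s
    calc _ ≤ ∑ i ∈ s, (K * ‖f i‖) ^ (2 : ENNReal).toReal :=
          Finset.sum_le_sum fun i _ => Real.rpow_le_rpow (norm_nonneg _) (hS i _) (by norm_num)
      _ = K ^ (2 : ENNReal).toReal * ∑ i ∈ s, ‖f i‖ ^ (2 : ENNReal).toReal := by
          rw [Finset.mul_sum]
          exact Finset.sum_congr rfl fun i _ => Real.mul_rpow hK (norm_nonneg _)
      _ ≤ K ^ (2 : ENNReal).toReal * ‖f‖ ^ (2 : ENNReal).toReal := by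
          gcongr
          exact lp.sum_rpow_le_norm_rpow (by norm_num) f s
      _ = _ := (Real.mul_rpow hK (norm_nonneg _)).symm
  exact ⟨memℓp_gen' hsum, fun h => lp.norm_le_of_forall_sum_le (by norm_num) (by positivity) hsum⟩

/-- The bounded direct sum of uniformly bounded operators. -/
def boundedDirectSum (S : ∀ i, E i →L[ℂ] E i) (K : ℝ) (hK : 0 ≤ K)
    (hS : ∀ i f, ‖S i f‖ ≤ K * ‖f‖) : lp E 2 →L[ℂ] lp E 2 :=
  LinearMap.mkContinuous
    { toFun := fun f => ⟨fun i => S i (f i), (memℓp_map hK hS f).1⟩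
      map_add' := fun f g => by ext i; simp; rfl
      map_smul' := fun c f => by ext i; simp } K
    fun f => (memℓp_map hK hS f).2 _

/-- Uniformly bounded resolvents sum up to a resolvent of the direct sum. -/
lemma mem_pmapResolventSet_directSumOp {T : ∀ i, E i →L[ℂ] E i} {z : ℂ} {K : ℝ} (hK : 0 ≤ K)
    (h : ∀ i, ∃ R : E i →L[ℂ] E i, (∀ f, T i (R f) - z • R f = f) ∧
      (∀ f, R (T i f - z • f) = f) ∧ ∀ f, ‖R f‖ ≤ K * ‖f‖) :
    z ∈ pmapResolventSet (directSumOp E T) := by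
  choose R h1 h2 h3 using h
  refine ⟨boundedDirectSum R K hK h3, fun f => ?_, fun f => ?_⟩
  · have hdom : boundedDirectSum R K hK h3 f ∈ (directSumOp E T).domain := by
      have e : (fun i => T i (R i (f i))) = fun i => (f + z • boundedDirectSum R K hK h3 f) i := by
        funext i
        exact sub_eq_iff_eq_add.1 (h1 i (f i))
      change Memℓp (fun i => T i (R i (f i))) 2
      rw [e]
      exact lp.memℓp _
    refine ⟨hdom, ?_⟩
    ext i
    exact h1 i (f i)
  · ext i
    exact h2 i _

/-- Every spectral value of a summand belongs to the spectrum of the direct sum. -/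
lemma realSpectrum_subset_directSumOp (T : ∀ i, E i →L[ℂ] E i) (i : ι) :
    realSpectrum (T i) ⊆ pmapRealSpectrum (directSumOp E T) := by
  intro x hx hres
  obtain ⟨R, h1, h2⟩ := hres
  -- The compression of a resolvent of the sum to the summand `i` is a resolvent of `T i`.
  refine absurd hx ((notMem_realSpectrum_iff (T i) x).2
    ⟨(lp.evalCLM ℂ E 2 i).comp (R.comp (lp.singleContinuousLinearMap ℂ E 2 i)),
      fun f => ?_, fun f => ?_⟩)
  · obtain ⟨hd, hf⟩ := h1 (lp.single 2 i f)
    have := congrArg (fun g : lp E 2 => g i) hf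
    simp only [lp.single_apply_self] at this
    exact this
  · have e : (fun j => T j ((lp.single 2 i f : lp E 2) j)) = (lp.single 2 i (T i f) : lp E 2) := by
      funext j
      by_cases hj : j = i
      · subst hj; simp
      · rw [lp.single_apply_ne _ _ _ hj, lp.single_apply_ne _ _ _ hj, map_zero]
    have hd : lp.single 2 i f ∈ (directSumOp E T).domain := by
      change Memℓp (fun j => T j ((lp.single 2 i f : lp E 2) j)) 2
      rw [e]
      exact lp.memℓp _
    have h3 := h2 ⟨_, hd⟩
    have h4 : directSumOp E T ⟨_, hd⟩ = lp.single 2 i (T i f) := by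
      ext1
      exact e
    rw [h4] at h3
    change (R (lp.single 2 i (T i f - (x : ℂ) • f))) i = f
    rw [lp.single_sub, lp.single_smul, h3]
    exact lp.single_apply_self _ _ _

end DirectSum

/-! ### Hopping rates and the weight -/

section Rates

variable {V : Type*} {M N : ℕ} (G : SimpleGraph V)

/-- `n` arises from `m` by moving one particle along `p`. -/
def IsMove (m n : Config V M N) (p : V × V) : Prop :=
  G.Adj p.1 p.2 ∧ m.occ p.1 = n.occ p.1 + 1 ∧ n.occ p.2 = m.occ p.2 + 1 ∧
    ∀ z, z ≠ p.1 → z ≠ p.2 → m.occ z = n.occ z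

variable {G} {m n n' : Config V M N} {p q : V × V}

lemma IsMove.swap (h : IsMove G m n p) : IsMove G n m p.swap :=
  ⟨h.1.symm, h.2.2.1, h.2.1, fun z h1 h2 => (h.2.2.2 z h2 h1).symm⟩

lemma IsMove.fst_eq (h : IsMove G m n p) (h' : IsMove G m n q) : p.1 = q.1 := by
  by_contra hne
  have h1 := h.2.1
  by_cases h2 : p.1 = q.2
  · have := h'.2.2.1
    rw [← h2] at this
    omega
  · have := h'.2.2.2 _ hne h2
    omega

lemma IsMove.unique (h : IsMove G m n p) (h' : IsMove G m n q) : p = q :=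
  Prod.ext (h.fst_eq h') (h.swap.fst_eq h'.swap)

lemma IsMove.target_unique (h : IsMove G m n p) (h' : IsMove G m n' p) : n = n' := by
  refine Config.ext' fun z => ?_
  have a1 := h.2.1
  have a2 := h.2.2.1
  have b1 := h'.2.1
  have b2 := h'.2.2.1
  by_cases h1 : z = p.1
  · subst h1; omega
  by_cases h2 : z = p.2
  · subst h2; omega
  rw [← h.2.2.2 z h1 h2, ← h'.2.2.2 z h1 h2]

lemma exists_isMove (h : (particleGraph G M N).Adj m n) : ∃ p, IsMove G m n p := by
  obtain ⟨x, y, h⟩ := h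
  exact ⟨(x, y), h⟩

lemma weight_comm (m n : Config V M N) : weight m n = weight n m := by
  unfold weight
  rw [Finsupp.neLocus_comm]
  refine Finset.prod_congr rfl fun x _ => ?_
  congr 1
  ring

/-- The two factors under the root are `m(x)(M - n(x))` and `n(y)(M - m(y))`. Regrouped, they are
the rate of the move and that of its reverse. -/
lemma IsMove.weight_eq (h : IsMove G m n p) :
    weight m n = Real.sqrt (hopRate m p) * Real.sqrt (hopRate n p.swap) := by
  obtain ⟨hadj, hx, hy, hz⟩ := h
  have hloc : m.1.neLocus n.1 = {p.1, p.2} := by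
    ext z
    rw [Finsupp.mem_neLocus, Finset.mem_insert, Finset.mem_singleton]
    change m.occ z ≠ n.occ z ↔ _
    constructor
    · intro h
      by_contra hcon
      rw [not_or] at hcon
      exact h (hz z hcon.1 hcon.2)
    · rintro (rfl | rfl) <;> omega
  have hmx : (m.occ p.1 : ℝ) = n.occ p.1 + 1 := by exact_mod_cast hx
  have hny : (n.occ p.2 : ℝ) = m.occ p.2 + 1 := by exact_mod_cast hy
  have e1 : (M : ℝ) / 2 * (m.occ p.1 + n.occ p.1 + 1) - m.occ p.1 * n.occ p.1 =
      m.occ p.1 * (M - n.occ p.1) := by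
    rw [hmx]; ring
  have e2 : (M : ℝ) / 2 * (m.occ p.2 + n.occ p.2 + 1) - m.occ p.2 * n.occ p.2 =
      n.occ p.2 * (M - m.occ p.2) := by
    rw [hny]; ring
  have b1 : (0 : ℝ) ≤ M - n.occ p.1 := sub_nonneg.2 (Nat.cast_le.2 (occ_le n _))
  unfold weight
  rw [hloc, Finset.prod_pair hadj.ne, e1, e2,
    ← Real.sqrt_mul (mul_nonneg (Nat.cast_nonneg _) b1), ← Real.sqrt_mul (hopRate_nonneg m p)]
  congr 1
  simp only [hopRate, Prod.fst_swap, Prod.snd_swap]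
  ring

variable (G) in
/-- The rate of the unique move from `m` to `n`, zero if there is none. -/
def rate (m n : Config V M N) : ℝ :=
  if h : ∃ p, IsMove G m n p then hopRate m h.choose else 0

lemma IsMove.rate_eq (h : IsMove G m n p) : rate G m n = hopRate m p := by
  have hex : ∃ p, IsMove G m n p := ⟨p, h⟩
  rw [rate, dif_pos hex, hex.choose_spec.unique h]

/-- The inequality of arithmetic and geometric means for the two rates. -/
lemma two_weight_mul_le (h : (particleGraph G M N).Adj m n) (a b : ℝ) :
    2 * (weight m n * (a * b)) ≤ rate G m n * a ^ 2 + rate G n m * b ^ 2 := by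
  obtain ⟨p, hp⟩ := exists_isMove h
  rw [hp.rate_eq, hp.swap.rate_eq, hp.weight_eq]
  have h1 := Real.sq_sqrt (hopRate_nonneg m p)
  have h2 := Real.sq_sqrt (hopRate_nonneg n p.swap)
  nlinarith [sq_nonneg (Real.sqrt (hopRate m p) * a - Real.sqrt (hopRate n p.swap) * b)]

/-- The total rate of the moves out of `m` is at most twice the potential. -/
lemma sum_rate_le (hG : BoundedDegree G) (m : Config V M N) (T : Finset (Config V M N))
    (hT : ∀ n ∈ T, (particleGraph G M N).Adj m n) : ∑ n ∈ T, rate G m n ≤ 2 * potential G m := by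
  rcases T.eq_empty_or_nonempty with rfl | ⟨n₀, h₀⟩
  · simpa using potential_nonneg hG m
  have : Nonempty (V × V) := ⟨(exists_isMove (hT n₀ h₀)).choose⟩
  choose! p hp using fun n (hn : n ∈ T) => exists_isMove (hT n hn)
  rw [two_mul_potential hG m subset_rfl]
  -- The edge of a move determines its target, so distinct neighbours use distinct terms of the dart
  -- sum for `2V(m)`.
  have hinj : Set.InjOn p T := fun n hn n' hn' h =>
    (hp n hn).target_unique (h ▸ hp n' hn')
  calc ∑ n ∈ T, rate G m n = ∑ n ∈ T, hopRate m (p n) :=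
        Finset.sum_congr rfl fun n hn => (hp n hn).rate_eq
    _ = ∑ q ∈ T.image p, hopRate m q := (Finset.sum_image hinj).symm
    _ ≤ _ := by
        refine Finset.sum_le_sum_of_subset_of_nonneg (fun q hq => ?_)
          fun q _ _ => hopRate_nonneg m q
        obtain ⟨n, hn, rfl⟩ := Finset.mem_image.1 hq
        refine (mem_dartsFrom hG).2 ⟨?_, (hp n hn).1⟩
        have : m.1 (p n).1 ≠ 0 := by
          have := (hp n hn).2.1
          change m.occ _ ≠ 0
          omega
        exact Finsupp.mem_support_iff.2 this

end Rates

/-! ### Form bounds for the Hamiltonian -/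

section Operators

variable {V : Type*} {M N : ℕ} {G : SimpleGraph V}

lemma particleGraph_neighborSet_finite (hG : BoundedDegree G) (m : Config V M N) :
    ((particleGraph G M N).neighborSet m).Finite :=
  Set.finite_of_encard_le_coe (neighbor_encard_le G hG.choose_spec m)

lemma inner_single_one {ι : Type*} (f : lp (fun _ : ι => ℂ) 2) (i : ι) :
    inner ℂ (lp.single 2 i (1 : ℂ)) f = f i := by
  rw [lp.inner_single_left]
  simp

/-- Pairing with basis vectors recovers the coordinates, so the adjoint relation need only be tested
on them. -/
lemma isSelfAdjoint_of_matrix {ι : Type*} {T : lp (fun _ : ι => ℂ) 2 →L[ℂ] lp (fun _ : ι => ℂ) 2}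
    (h : ∀ i f, inner ℂ (T (lp.single 2 i (1 : ℂ))) f = T f i) : IsSelfAdjoint T := by
  rw [ContinuousLinearMap.isSelfAdjoint_iff']
  ext f i
  rw [← inner_single_one, ContinuousLinearMap.adjoint_inner_right, h]

variable (hG : BoundedDegree G)

lemma adjacencyOp_single (m n : Config V M N) :
    adjacencyOp G hG M N (lp.single 2 m (1 : ℂ)) n =
      if (particleGraph G M N).Adj n m then (weight n m : ℂ) else 0 := by
  rw [adjacencyOp_apply, finsum_mem_eq_finite_toFinset_sum _ (particleGraph_neighborSet_finite hG n)]
  simp only [lp.coeFn_single, Pi.single_apply, mul_ite, mul_one, mul_zero, Finset.sum_ite_eq',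
    Set.Finite.mem_toFinset, SimpleGraph.mem_neighborSet]

lemma isSelfAdjoint_adjacencyOp : IsSelfAdjoint (adjacencyOp G hG M N) := by
  refine isSelfAdjoint_of_matrix fun m f => ?_
  rw [lp.inner_eq_tsum, adjacencyOp_apply,
    finsum_mem_eq_finite_toFinset_sum _ (particleGraph_neighborSet_finite hG m),
    tsum_eq_sum (s := (particleGraph_neighborSet_finite hG m).toFinset)]
  · refine Finset.sum_congr rfl fun n hn => ?_
    rw [Set.Finite.mem_toFinset, SimpleGraph.mem_neighborSet] at hn
    rw [adjacencyOp_single, if_pos hn.symm, RCLike.inner_apply, Complex.conj_ofReal,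
      weight_comm n m, mul_comm]
  · intro n hn
    rw [Set.Finite.mem_toFinset, SimpleGraph.mem_neighborSet] at hn
    rw [adjacencyOp_single, if_neg fun h => hn h.symm, inner_zero_left]

lemma isSelfAdjoint_diagonal {ι : Type*}
    {T : lp (fun _ : ι => ℂ) 2 →L[ℂ] lp (fun _ : ι => ℂ) 2} {s : ι → ℝ}
    (h : ∀ f i, T f i = (s i : ℂ) * f i) : IsSelfAdjoint T := by
  refine isSelfAdjoint_of_matrix fun i f => ?_
  have : T (lp.single 2 i (1 : ℂ)) = (s i : ℂ) • lp.single 2 i (1 : ℂ) := by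
    ext j
    rw [h, lp.coeFn_smul, Pi.smul_apply, smul_eq_mul]
    by_cases hj : j = i
    · subst hj; rfl
    · rw [lp.single_apply_ne _ _ _ hj, mul_zero, mul_zero]
  rw [this, inner_smul_left, inner_single_one, Complex.conj_ofReal, h]

lemma isSelfAdjoint_hamiltonian (Δ : ℝ) : IsSelfAdjoint (hamiltonian G hG M N Δ) := by
  have hc : IsSelfAdjoint (-(1 / (2 * Δ)) : ℂ) := by
    have : (-(1 / (2 * Δ)) : ℂ) = ((-(1 / (2 * Δ)) : ℝ) : ℂ) := by push_cast; rfl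
    rw [this]
    exact Complex.conj_ofReal _
  exact (hc.smul (isSelfAdjoint_adjacencyOp hG)).add
    (isSelfAdjoint_diagonal (potentialOp_apply G hG M N))

lemma hasSum_re_inner {ι : Type*} (f g : lp (fun _ : ι => ℂ) 2) :
    HasSum (fun i => (inner ℂ (f i) (g i)).re) (inner ℂ f g).re :=
  Complex.reCLM.hasSum (lp.hasSum_inner (𝕜 := ℂ) f g)

lemma re_inner_real_mul (c : ℝ) (z : ℂ) : (inner ℂ ((c : ℂ) * z) z).re = c * ‖z‖ ^ 2 := by
  rw [← smul_eq_mul, re_inner_real_smul_self]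

/-- The adjacency form is dominated by twice the potential form on finitely supported vectors. -/
lemma abs_adjacency_form_le_of_finite (f : HilbertN V M N) (T : Finset (Config V M N))
    (hf : ∀ m, m ∉ T → f m = 0) :
    |(inner ℂ (adjacencyOp G hG M N f) f).re| ≤ 2 * (inner ℂ (potentialOp G hG M N f) f).re := by
  have hA : (inner ℂ (adjacencyOp G hG M N f) f).re =
      ∑ m ∈ T, ∑ n ∈ T, (if (particleGraph G M N).Adj m n then
        (inner ℂ ((weight m n : ℂ) * f n) (f m)).re else 0) := by
    rw [← (hasSum_re_inner _ _).tsum_eq, tsum_eq_sum (s := T) fun m hm => by simp [hf m hm]]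
    refine Finset.sum_congr rfl fun m _ => ?_
    have : adjacencyOp G hG M N f m =
        ∑ n ∈ T, if (particleGraph G M N).Adj m n then (weight m n : ℂ) * f n else 0 := by
      rw [adjacencyOp_apply, ← Finset.sum_filter]
      refine finsum_mem_eq_sum_of_inter_support_eq _ ?_
      ext n
      simp only [Set.mem_inter_iff, SimpleGraph.mem_neighborSet, Function.mem_support,
        Finset.coe_filter, Set.mem_ofPred_eq]
      refine ⟨fun h => ⟨⟨?_, h.1⟩, h.2⟩, fun h => ⟨h.1.2, h.2⟩⟩
      by_contra hn
      exact h.2 (by rw [hf n hn, mul_zero])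
    rw [this, sum_inner, Complex.re_sum]
    refine Finset.sum_congr rfl fun n _ => ?_
    split_ifs
    · rfl
    · simp
  have hV : (inner ℂ (potentialOp G hG M N f) f).re = ∑ m ∈ T, potential G m * ‖f m‖ ^ 2 := by
    rw [← (hasSum_re_inner _ _).tsum_eq, tsum_eq_sum (s := T) fun m hm => by simp [hf m hm]]
    refine Finset.sum_congr rfl fun m _ => ?_
    rw [potentialOp_apply, re_inner_real_mul]
  -- Each matrix element is split between its two endpoints according to the rates. Summed over both
  -- indices the halves coincide, leaving the total rate out of each `m`.
  have h1 : ∀ m n : Config V M N, |if (particleGraph G M N).Adj m n then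
      (inner ℂ ((weight m n : ℂ) * f n) (f m)).re else 0| ≤
      ((if (particleGraph G M N).Adj m n then rate G m n else 0) * ‖f m‖ ^ 2 +
        (if (particleGraph G M N).Adj n m then rate G n m else 0) * ‖f n‖ ^ 2) / 2 := by
    intro m n
    rw [(particleGraph G M N).adj_comm n m]
    split_ifs with h
    · have h2 := two_weight_mul_le h ‖f m‖ ‖f n‖
      have h3 : |(inner ℂ ((weight m n : ℂ) * f n) (f m)).re| ≤ weight m n * (‖f m‖ * ‖f n‖) := by
        refine (Complex.abs_re_le_norm _).trans ((norm_inner_le_norm _ _).trans (le_of_eq ?_))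
        rw [norm_mul, Complex.norm_real, Real.norm_of_nonneg (weight_nonneg m n)]
        ring
      linarith
    · simp
  rw [hA, hV]
  calc _ ≤ ∑ m ∈ T, ∑ n ∈ T,
        ((if (particleGraph G M N).Adj m n then rate G m n else 0) * ‖f m‖ ^ 2 +
          (if (particleGraph G M N).Adj n m then rate G n m else 0) * ‖f n‖ ^ 2) / 2 :=
        (Finset.abs_sum_le_sum_abs _ _).trans (Finset.sum_le_sum fun m _ =>
          (Finset.abs_sum_le_sum_abs _ _).trans (Finset.sum_le_sum fun n _ => h1 m n))
    _ = ∑ m ∈ T, ∑ n ∈ T,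
        (if (particleGraph G M N).Adj m n then rate G m n else 0) * ‖f m‖ ^ 2 := by
        simp only [← Finset.sum_div, Finset.sum_add_distrib]
        rw [Finset.sum_comm (f := fun m n =>
          (if (particleGraph G M N).Adj n m then rate G n m else 0) * ‖f n‖ ^ 2)]
        exact add_self_div_two _
    _ ≤ ∑ m ∈ T, 2 * (potential G m * ‖f m‖ ^ 2) := by
        refine Finset.sum_le_sum fun m _ => ?_
        rw [← Finset.sum_mul, ← mul_assoc]
        refine mul_le_mul_of_nonneg_right ?_ (sq_nonneg _)
        rw [← Finset.sum_filter]
        exact sum_rate_le hG m _ fun n hn => (Finset.mem_filter.1 hn).2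
    _ = _ := by rw [Finset.mul_sum]

/-- The adjacency form is dominated by twice the potential form. -/
lemma abs_adjacency_form_le (f : HilbertN V M N) :
    |(inner ℂ (adjacencyOp G hG M N f) f).re| ≤ 2 * (inner ℂ (potentialOp G hG M N f) f).re := by
  -- Both sides are continuous in `f`, so finite truncations suffice.
  have hlim : Tendsto (fun T : Finset (Config V M N) => ∑ m ∈ T, lp.single 2 m (f m)) atTop (𝓝 f) :=
    lp.hasSum_single (p := 2) (by norm_num) f
  have hc1 : Continuous fun g : HilbertN V M N => |(inner ℂ (adjacencyOp G hG M N g) g).re| := by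
    fun_prop
  have hc2 : Continuous fun g : HilbertN V M N =>
      2 * (inner ℂ (potentialOp G hG M N g) g).re := by
    fun_prop
  refine le_of_tendsto_of_tendsto' ((hc1.tendsto f).comp hlim) ((hc2.tendsto f).comp hlim)
    fun T => abs_adjacency_form_le_of_finite hG _ T fun m hm => ?_
  rw [lp.coeFn_sum, Finset.sum_apply]
  exact Finset.sum_eq_zero fun n hn => lp.single_apply_ne _ _ _ fun h => hm (h ▸ hn)

lemma re_inner_hamiltonian (Δ : ℝ) (f : HilbertN V M N) :
    (inner ℂ (hamiltonian G hG M N Δ f) f).re = (inner ℂ (potentialOp G hG M N f) f).re -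
      1 / (2 * Δ) * (inner ℂ (adjacencyOp G hG M N f) f).re := by
  have hc : (-(1 / (2 * Δ)) : ℂ) = ((-(1 / (2 * Δ)) : ℝ) : ℂ) := by push_cast; rfl
  rw [hamiltonian, hc, add_apply, smul_apply, inner_add_left, inner_smul_left,
    Complex.conj_ofReal, Complex.add_re, Complex.re_ofReal_mul]
  ring

lemma hamiltonian_form_ge {Δ : ℝ} (hΔ : 0 < Δ) (f : HilbertN V M N) :
    (1 - 1 / Δ) * (inner ℂ (potentialOp G hG M N f) f).re ≤
      (inner ℂ (hamiltonian G hG M N Δ f) f).re := by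
  have h := (abs_le.1 (abs_adjacency_form_le hG f)).2
  rw [re_inner_hamiltonian]
  have h1 : 0 < 1 / (2 * Δ) := by positivity
  have h2 := mul_le_mul_of_nonneg_left h h1.le
  have h3 : 1 / (2 * Δ) * (2 * (inner ℂ (potentialOp G hG M N f) f).re) =
      1 / Δ * (inner ℂ (potentialOp G hG M N f) f).re := by
    field_simp
  linarith

lemma potential_form_ge {W : ℝ} (f : HilbertN V M N) (hf : ∀ m, f m = 0 ∨ W ≤ potential G m) :
    W * ‖f‖ ^ 2 ≤ (inner ℂ (potentialOp G hG M N f) f).re := by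
  rw [← re_inner_real_smul_self]
  refine hasSum_le (fun m => ?_) (hasSum_re_inner _ _) (hasSum_re_inner _ _)
  rw [lp.coeFn_smul, Pi.smul_apply, smul_eq_mul, potentialOp_apply, re_inner_real_mul,
    re_inner_real_mul]
  rcases hf m with h | h
  · simp [h]
  · exact mul_le_mul_of_nonneg_right h (sq_nonneg _)

/-- The orthogonal projection to the vectors supported in `s`. -/
def supportProj {ι : Type*} (s : Set ι) :
    lp (fun _ : ι => ℂ) 2 →L[ℂ] lp (fun _ : ι => ℂ) 2 :=
  mkOp (fun f i => ((if i ∈ s then 1 else 0 : ℝ) : ℂ) * f i) 1 zero_le_one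
    (fun f g => by ext i; simp [mul_add])
    (fun a f => by ext i; simp [mul_left_comm])
    (fun f F => by
      rw [one_mul]
      refine (Finset.sum_le_sum fun i _ => ?_).trans (sum_norm_sq_le f F)
      split_ifs <;> simp)

lemma supportProj_apply {ι : Type*} (s : Set ι) (f : lp (fun _ : ι => ℂ) 2) (i : ι) :
    supportProj s f i = ((if i ∈ s then 1 else 0 : ℝ) : ℂ) * f i := rfl

lemma supportProj_supportProj {ι : Type*} (s : Set ι) (f : lp (fun _ : ι => ℂ) 2) :
    supportProj s (supportProj s f) = supportProj s f := by
  ext i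
  simp only [supportProj_apply]
  split_ifs <;> simp

variable {v₀ : ℝ}

/-- If no two configurations of potential `v₀` are adjacent, the Hamiltonian acts as `v₀` in the
form sense on vectors supported on them. -/
lemma hamiltonian_form_supportProj (Δ : ℝ)
    (hadj : ∀ m n : Config V M N, (particleGraph G M N).Adj m n → potential G m = v₀ →
      potential G n ≠ v₀) (f : HilbertN V M N) :
    (inner ℂ (hamiltonian G hG M N Δ (supportProj {m | potential G m = v₀} f))
      (supportProj {m | potential G m = v₀} f)).re =
        v₀ * ‖supportProj {m | potential G m = v₀} f‖ ^ 2 := by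
  set g := supportProj {m : Config V M N | potential G m = v₀} f with hg
  have hg0 : ∀ m, potential G m ≠ v₀ → g m = 0 := fun m hm => by
    rw [hg, supportProj_apply, if_neg (by simpa using hm)]
    simp
  have h1 : inner ℂ (adjacencyOp G hG M N g) g = 0 := by
    rw [lp.inner_eq_tsum]
    refine (tsum_congr fun m => ?_).trans tsum_zero
    by_cases hm : potential G m = v₀
    · have : adjacencyOp G hG M N g m = 0 := by
        rw [adjacencyOp_apply]
        refine finsum_mem_eq_zero_of_forall_eq_zero fun n hn => ?_
        rw [hg0 n (hadj m n hn hm), mul_zero]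
      rw [this, inner_zero_left]
    · rw [hg0 m hm, inner_zero_right]
  have h2 : potentialOp G hG M N g = (v₀ : ℂ) • g := by
    ext m
    rw [potentialOp_apply, lp.coeFn_smul, Pi.smul_apply, smul_eq_mul]
    by_cases hm : potential G m = v₀
    · rw [hm]
    · rw [hg0 m hm, mul_zero, mul_zero]
  rw [re_inner_hamiltonian, h1, h2, re_inner_real_smul_self]
  simp

lemma hamiltonian_form_compl {W Δ : ℝ} (hΔ : 1 < Δ)
    (hgap : ∀ m : Config V M N, potential G m = v₀ ∨ W ≤ potential G m) (f : HilbertN V M N) :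
    (1 - 1 / Δ) * W * ‖f - supportProj {m | potential G m = v₀} f‖ ^ 2 ≤
      (inner ℂ (hamiltonian G hG M N Δ (f - supportProj {m | potential G m = v₀} f))
        (f - supportProj {m | potential G m = v₀} f)).re := by
  refine le_trans ?_ (hamiltonian_form_ge hG (by linarith) _)
  rw [mul_assoc]
  refine mul_le_mul_of_nonneg_left (potential_form_ge hG _ fun m => ?_) ?_
  · refine (hgap m).imp_left fun h => ?_
    rw [lp.coeFn_sub, Pi.sub_apply, supportProj_apply, if_pos (by simpa using h)]
    simp
  · rw [sub_nonneg, div_le_one (by linarith)]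
    exact hΔ.le

/-- The resolvent of the Hamiltonian between `v₀` and the rest of the potential landscape. -/
lemma exists_hamiltonian_resolvent {W Δ E c : ℝ} (hΔ : 1 < Δ)
    (hadj : ∀ m n : Config V M N, (particleGraph G M N).Adj m n → potential G m = v₀ →
      potential G n ≠ v₀)
    (hgap : ∀ m : Config V M N, potential G m = v₀ ∨ W ≤ potential G m)
    (hc : 0 < c) (hc1 : c ≤ E - v₀) (hc2 : c ≤ (1 - 1 / Δ) * W - E) :
    ∃ R : HilbertN V M N →L[ℂ] HilbertN V M N,
      (∀ f, hamiltonian G hG M N Δ (R f) - (E : ℂ) • R f = f) ∧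
      (∀ f, R (hamiltonian G hG M N Δ f - (E : ℂ) • f) = f) ∧ ∀ f, ‖R f‖ ≤ c⁻¹ * ‖f‖ :=
  exists_resolvent (isSelfAdjoint_hamiltonian hG Δ)
    (isSelfAdjoint_diagonal (supportProj_apply {m | potential G m = v₀}))
    (supportProj_supportProj _) (fun f => (hamiltonian_form_supportProj hG Δ hadj f).le)
    (hamiltonian_form_compl hG hΔ hgap) hc hc1 hc2

/-- The adjacency operator has zero diagonal. Basis vectors thus serve as trial vectors that locate
spectrum below and above each value of the potential. -/
lemma hamiltonian_single_form (Δ : ℝ) (m : Config V M N) :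
    (inner ℂ (hamiltonian G hG M N Δ (lp.single 2 m (1 : ℂ))) (lp.single 2 m (1 : ℂ))).re =
      potential G m := by
  rw [re_inner_hamiltonian, lp.inner_single_right, lp.inner_single_right, adjacencyOp_single,
    potentialOp_apply, lp.single_apply_self, if_neg ((particleGraph G M N).loopless.irrefl m)]
  simp

lemma single_one_ne_zero {ι : Type*} (i : ι) :
    (lp.single 2 i (1 : ℂ) : lp (fun _ : ι => ℂ) 2) ≠ 0 := fun h => by
  have := congrArg (fun f : lp (fun _ : ι => ℂ) 2 => f i) h
  rw [lp.single_apply_self] at this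
  exact one_ne_zero this

lemma norm_single_one {ι : Type*} (i : ι) :
    ‖(lp.single 2 i (1 : ℂ) : lp (fun _ : ι => ℂ) 2)‖ = 1 := by
  rw [lp.norm_single (by norm_num)]
  simp

lemma exists_hamiltonian_spectrum_le (Δ : ℝ) (m : Config V M N) :
    (realSpectrum (hamiltonian G hG M N Δ) ∩ Set.Iic (potential G m)).Nonempty :=
  exists_spectrum_le (isSelfAdjoint_hamiltonian hG Δ) (single_one_ne_zero m) (by
    rw [hamiltonian_single_form, norm_single_one]; simp)

lemma exists_hamiltonian_le_spectrum (Δ : ℝ) (m : Config V M N) :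
    (realSpectrum (hamiltonian G hG M N Δ) ∩ Set.Ici (potential G m)).Nonempty :=
  exists_le_spectrum (isSelfAdjoint_hamiltonian hG Δ) (single_one_ne_zero m) (by
    rw [hamiltonian_single_form, norm_single_one]; simp)

end Operators

/-! ### The spectral gap in the strip -/

section StripSpectrum

variable {L M k : ℕ}

lemma exists_of_mem_stripNumbers {N : ℕ} (hN : N ∈ stripNumbers L M) :
    ∃ k, L ≤ 2 * k ∧ N = k * L * M := by
  obtain ⟨k, hk, rfl⟩ := hN
  refine ⟨k, ?_, rfl⟩
  have : (L : ℝ) ≤ 2 * k := by linarith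
  exact_mod_cast this

lemma strip_potentialMin (hL : 2 ≤ L) (hk : L ≤ 2 * k) (hM : 2 ≤ M) :
    potentialMin (strip L) M (k * L * M) = L * M ^ 2 := by
  refine IsLeast.csInf_eq ⟨⟨droplet L M k, potential_droplet hL hk hM⟩, ?_⟩
  rintro _ ⟨m, rfl⟩
  exact strip_potential_ge hL hk hM m

lemma exists_strip_potential_ne (hL : 2 ≤ L) (hk : L ≤ 2 * k) (hM : 2 ≤ M) :
    ∃ n : Config (ℤ × Fin L) M (k * L * M), potential (strip L) n ≠ L * M ^ 2 := by
  obtain ⟨n, hn⟩ := exists_adj_droplet hL hk hM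
  exact ⟨n, strip_minimizers_not_adj hL hk hM hn (potential_droplet hL hk hM)⟩

lemma strip_potentialSnd_ge (hL : 2 ≤ L) (hk : L ≤ 2 * k) (hM : 2 ≤ M) :
    L * (M : ℝ) ^ 2 + 1 ≤ potentialSnd (strip L) M (k * L * M) := by
  obtain ⟨n, hn⟩ := exists_strip_potential_ne hL hk hM
  rw [potentialSnd, strip_potentialMin hL hk hM]
  -- The infimum defining `potentialSnd` needs a non-minimizer; a neighbour of the droplet is one.
  refine le_csInf ⟨_, ⟨n, rfl⟩, hn⟩ ?_
  rintro _ ⟨⟨m, rfl⟩, hm⟩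
  exact (strip_potential_eq_or_ge hL hk hM m).resolve_left hm

lemma strip_potential_eq_or_snd_le (hL : 2 ≤ L) (hk : L ≤ 2 * k) (hM : 2 ≤ M)
    (m : Config (ℤ × Fin L) M (k * L * M)) : potential (strip L) m = L * M ^ 2 ∨
      potentialSnd (strip L) M (k * L * M) ≤ potential (strip L) m := by
  refine or_iff_not_imp_left.2 fun hm => csInf_le ⟨0, ?_⟩ ⟨⟨m, rfl⟩, ?_⟩
  · rintro _ ⟨⟨n, rfl⟩, -⟩
    exact potential_nonneg (strip_boundedDegree L) n
  · rw [strip_potentialMin hL hk hM]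
    exact hm

lemma one_sub_div_mono (hM : 2 ≤ M) {Δ : ℝ} (hΔ : 0 < Δ) {W : ℝ} (hW : 0 ≤ W) :
    (1 - M / Δ) * W ≤ (1 - 1 / Δ) * W := by
  have hM' : (1 : ℝ) ≤ M := by exact_mod_cast (by omega : 1 ≤ M)
  gcongr

/-- Uniform resolvent bound for the strip Hamiltonian above the minimal potential. -/
lemma exists_strip_resolvent (hL : 2 ≤ L) (hk : L ≤ 2 * k) (hM : 2 ≤ M) {Δ W E c : ℝ}
    (hΔ : 1 < Δ) (hW : 0 ≤ W)
    (hgap : ∀ m : Config (ℤ × Fin L) M (k * L * M),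
      potential (strip L) m = L * M ^ 2 ∨ W ≤ potential (strip L) m)
    (hc : 0 < c) (hc1 : c ≤ E - L * M ^ 2) (hc2 : c ≤ (1 - M / Δ) * W - E) :
    ∃ R : HilbertN (ℤ × Fin L) M (k * L * M) →L[ℂ] HilbertN (ℤ × Fin L) M (k * L * M),
      (∀ f, stripHamiltonian L M (k * L * M) Δ (R f) - (E : ℂ) • R f = f) ∧
      (∀ f, R (stripHamiltonian L M (k * L * M) Δ f - (E : ℂ) • f) = f) ∧
      ∀ f, ‖R f‖ ≤ c⁻¹ * ‖f‖ :=
  exists_hamiltonian_resolvent (strip_boundedDegree L) hΔ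
    (fun _ _ h hm => strip_minimizers_not_adj hL hk hM h hm) hgap hc hc1
    (hc2.trans (sub_le_sub_right (one_sub_div_mono hM (by linarith) hW) E))

/-- The parameter `W` is `LM² + 1` for the gap common to all `N`, and `V_{N,2}` for the window that
defines the droplet spectrum. -/
lemma notMem_strip_spectrum (hL : 2 ≤ L) (hk : L ≤ 2 * k) (hM : 2 ≤ M) {Δ W E : ℝ}
    (hΔ : 1 < Δ) (hW : 0 ≤ W)
    (hgap : ∀ m : Config (ℤ × Fin L) M (k * L * M),
      potential (strip L) m = L * M ^ 2 ∨ W ≤ potential (strip L) m)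
    (h1 : L * (M : ℝ) ^ 2 < E) (h2 : E < (1 - M / Δ) * W) :
    E ∉ realSpectrum (stripHamiltonian L M (k * L * M) Δ) := by
  obtain ⟨R, hR1, hR2, -⟩ := exists_strip_resolvent hL hk hM hΔ hW hgap
    (lt_min (sub_pos.2 h1) (sub_pos.2 h2)) (min_le_left _ _) (min_le_right _ _)
  exact (notMem_realSpectrum_iff _ E).2 ⟨R, hR1, hR2⟩

lemma strip_spectrum_pos (hL : 2 ≤ L) (hk : L ≤ 2 * k) (hM : 2 ≤ M) {Δ E : ℝ} (hΔ : 1 < Δ)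
    (hE : E ∈ realSpectrum (stripHamiltonian L M (k * L * M) Δ)) : 0 < E := by
  have h1 : 0 < 1 - 1 / Δ := by
    rw [sub_pos, div_lt_one (by linarith)]
    exact hΔ
  have hL' : (0 : ℝ) < L := by exact_mod_cast (by omega : 0 < L)
  have hM' : (0 : ℝ) < M := by exact_mod_cast (by omega : 0 < M)
  have h2 : (1 - 1 / Δ) * (L * (M : ℝ) ^ 2) ≤ E := by
    refine spectrum_ge_of_form (isSelfAdjoint_hamiltonian (strip_boundedDegree L) Δ)
      (fun f => ?_) hE
    refine le_trans ?_ (hamiltonian_form_ge (strip_boundedDegree L) (by linarith) f)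
    rw [mul_assoc]
    exact mul_le_mul_of_nonneg_left (potential_form_ge _ f fun m =>
      Or.inr (strip_potential_ge hL hk hM m)) h1.le
  exact lt_of_lt_of_le (by positivity) h2

lemma strip_isSpectralGap (hL : 2 ≤ L) (hk : L ≤ 2 * k) (hM : 2 ≤ M) {Δ : ℝ} (hΔ : 1 < Δ)
    (hlt : L * (M : ℝ) ^ 2 < (1 - M / Δ) * (L * M ^ 2 + 1)) :
    IsSpectralGap (realSpectrum (stripHamiltonian L M (k * L * M) Δ)) (L * M ^ 2)
      ((1 - M / Δ) * (L * M ^ 2 + 1)) := by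
  refine ⟨hlt, ?_, ?_, ?_⟩
  · rw [Set.disjoint_right]
    rintro E ⟨h1, h2⟩
    exact notMem_strip_spectrum hL hk hM hΔ (by positivity)
      (strip_potential_eq_or_ge hL hk hM) h1 h2
  · have := exists_hamiltonian_spectrum_le (strip_boundedDegree L) Δ (droplet L M k)
    rwa [potential_droplet hL hk hM] at this
  · obtain ⟨n, hn⟩ := exists_strip_potential_ne hL hk hM
    obtain ⟨E, hE, hEn⟩ := exists_hamiltonian_le_spectrum (strip_boundedDegree L) Δ n
    refine ⟨E, hE, Set.mem_Ici.2 (le_trans ?_ hEn)⟩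
    refine le_trans ?_ ((strip_potential_eq_or_ge hL hk hM n).resolve_left hn)
    refine mul_le_of_le_one_left (by positivity) (sub_le_self _ ?_)
    exact div_nonneg (Nat.cast_nonneg _) (by linarith)

lemma strip_dropletSpectrum_le (hL : 2 ≤ L) (hk : L ≤ 2 * k) (hM : 2 ≤ M) {Δ : ℝ} (hΔ : 1 < Δ)
    {E : ℝ} (hE : E ∈ dropletSpectrum (strip L) (strip_boundedDegree L) M (k * L * M) Δ) :
    E ≤ L * M ^ 2 := by
  by_contra hcon
  have hW : 0 ≤ potentialSnd (strip L) M (k * L * M) :=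
    le_trans (by positivity) (strip_potentialSnd_ge hL hk hM)
  exact notMem_strip_spectrum hL hk hM hΔ hW (strip_potential_eq_or_snd_le hL hk hM)
    (not_le.1 hcon) hE.2.2 hE.1

lemma strip_dropletSpectrum_nonempty (hL : 2 ≤ L) (hk : L ≤ 2 * k) (hM : 2 ≤ M) {Δ : ℝ}
    (hΔ : (M : ℝ) < Δ) (hlt : L * (M : ℝ) ^ 2 < (1 - M / Δ) * (L * M ^ 2 + 1)) :
    (dropletSpectrum (strip L) (strip_boundedDegree L) M (k * L * M) Δ).Nonempty := by
  have hM' : (2 : ℝ) ≤ M := by exact_mod_cast hM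
  obtain ⟨E, hE, hEd⟩ := exists_hamiltonian_spectrum_le (strip_boundedDegree L) Δ (droplet L M k)
  rw [potential_droplet hL hk hM, Set.mem_Iic] at hEd
  refine ⟨E, hE, strip_spectrum_pos hL hk hM (by linarith) hE, hEd.trans_lt (hlt.trans_le ?_)⟩
  refine mul_le_mul_of_nonneg_left (strip_potentialSnd_ge hL hk hM) ?_
  rw [sub_nonneg, div_le_one (by linarith)]
  exact hΔ.le

lemma restrictedHamiltonian_isSpectralGap (hL : 2 ≤ L) (hM : 2 ≤ M) {Δ : ℝ} (hΔ : 1 < Δ)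
    (hlt : L * (M : ℝ) ^ 2 < (1 - M / Δ) * (L * M ^ 2 + 1)) :
    IsSpectralGap (pmapRealSpectrum (restrictedHamiltonian L M Δ)) (L * M ^ 2)
      ((1 - M / Δ) * (L * M ^ 2 + 1)) := by
  -- One summand, here `k = L`, supplies spectrum on both sides of the gap.
  have hmem : L * L * M ∈ stripNumbers L M := ⟨L, half_le_self (Nat.cast_nonneg _), rfl⟩
  have hsub : realSpectrum (stripHamiltonian L M (L * L * M) Δ) ⊆
      pmapRealSpectrum (restrictedHamiltonian L M Δ) :=
    realSpectrum_subset_directSumOp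
      (fun N : stripNumbers L M => stripHamiltonian L M N Δ) ⟨_, hmem⟩
  have hgap := strip_isSpectralGap (k := L) hL (by omega) hM hΔ hlt
  refine ⟨hlt, ?_, hgap.2.2.1.mono (Set.inter_subset_inter_left _ hsub),
    hgap.2.2.2.mono (Set.inter_subset_inter_left _ hsub)⟩
  rw [Set.disjoint_right]
  rintro E ⟨h1, h2⟩ hE
  have hc : 0 < min (E - L * (M : ℝ) ^ 2) ((1 - M / Δ) * (L * M ^ 2 + 1) - E) :=
    lt_min (sub_pos.2 h1) (sub_pos.2 h2)
  -- The distance of `E` to the endpoints bounds all resolvents uniformly in `N`.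
  refine hE (mem_pmapResolventSet_directSumOp (inv_nonneg.2 hc.le) ?_)
  rintro ⟨N, hN⟩
  obtain ⟨k, hk, rfl⟩ := exists_of_mem_stripNumbers hN
  exact exists_strip_resolvent hL hk hM hΔ (by positivity) (strip_potential_eq_or_ge hL hk hM) hc
    (min_le_left _ _) (min_le_right _ _)

end StripSpectrum

end XXZ

end

theorem mainTheorem4 (L M : ℕ) (hL : 2 ≤ L) (hM : 2 ≤ M) :
    ∃ C : ℝ, ∀ Δ : ℝ, (L : ℝ) * M ^ 3 + (1 + Real.sqrt (2 * L)) * M < Δ →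
      ∃ lo hi : ℝ,
        ((L : ℝ) * M ^ 2 ≤ lo ∧ lo ≤ L * M ^ 2 + C / Δ ^ 2) ∧
        ((1 - M / Δ) * (L * M ^ 2 + 1) - C / Δ ^ 2 ≤ hi ∧
          hi ≤ (1 - M / Δ) * (L * M ^ 2 + 1)) ∧
        (∀ N ∈ XXZ.stripNumbers L M,
          XXZ.IsSpectralGap (XXZ.realSpectrum (XXZ.stripHamiltonian L M N Δ)) lo hi ∧
          (XXZ.dropletSpectrum (XXZ.strip L) (XXZ.strip_boundedDegree L) M N Δ).Nonempty ∧
          ∀ E ∈ XXZ.dropletSpectrum (XXZ.strip L) (XXZ.strip_boundedDegree L) M N Δ, E ≤ lo) ∧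
        XXZ.IsSpectralGap (XXZ.pmapRealSpectrum (XXZ.restrictedHamiltonian L M Δ)) lo hi := by
  refine ⟨0, fun Δ hΔ => ⟨L * M ^ 2, (1 - M / Δ) * (L * M ^ 2 + 1), by simp, by simp, ?_⟩⟩
  have hM' : (2 : ℝ) ≤ M := by exact_mod_cast hM
  have hs : 0 ≤ Real.sqrt (2 * L) * M := by positivity
  have hL3 : (0 : ℝ) ≤ L * M ^ 3 := by positivity
  have hMΔ : (M : ℝ) < Δ := by nlinarith
  have hΔ0 : 0 < Δ := by linarith
  have hlt : L * (M : ℝ) ^ 2 < (1 - M / Δ) * (L * M ^ 2 + 1) := by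
    -- Equivalent to `LM³ + M < Δ`, which the threshold on `Δ` implies.
    have h1 : M / Δ * (L * (M : ℝ) ^ 2 + 1) < 1 := by
      rw [div_mul_eq_mul_div, div_lt_one hΔ0]
      nlinarith
    linarith
  refine ⟨fun N hN => ?_, XXZ.restrictedHamiltonian_isSpectralGap hL hM (by linarith) hlt⟩
  obtain ⟨k, hk, rfl⟩ := XXZ.exists_of_mem_stripNumbers hN
  exact ⟨XXZ.strip_isSpectralGap hL hk hM (by linarith) hlt,
    XXZ.strip_dropletSpectrum_nonempty hL hk hM hMΔ hlt,
    fun E hE => XXZ.strip_dropletSpectrum_le hL hk hM (by linarith) hE⟩
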